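/- All graphs are finite and simple. For a graph $G$, $\overline G$ denotes its complement, $\delta(G)$ its minimum degree, and $\rho(G)$ the largest eigenvalue of its adjacency matrix; $G$ is Hamiltonian (traceable) if it has a cycle (path) through all of its vertices. $G_1+G_2$ is the disjoint union and $G_1\vee G_2$ the join; $mK_1$ is the edgeless graph on $m$ vertices; equality of graphs means isomorphism. Put $$L_n^k=K_1\vee(K_k+K_{n-k-1})\quad(1\le k\le (n-1)/2),\qquad \underline{L}_n^k=K_{k+1}+K_{n-k-1}\quad(0\le k\le n/2-1),$$ and let $\mathcal H_n$ be the class of graphs $G$ of order $n$ with $K_{\lceil n/2\rceil-1,\lfloor n/2\rfloor+1}\subseteq G\subseteq K_{\lceil n/2\rceil-1}\vee(\lfloor n/2\rfloor+1)K_1$ (up to isomorphism, the three graphs having the same vertex set and the same two parts). **Theorem.** Let $k$ be an integer and $n$ a positive integer. (1) Let $k\ge 0$ and $n\ge 2k+2$. If $G$ is a graph of order $n$ with $\delta(G)\ge k$ and $\rho(\overline G)\le\rho(\overline{\underline{L}_n^k})$, then $G$ is traceable if and only if it is none of the following exceptions: $G=\underline{L}_n^k$, or $n=2k+2$ and $G\in\mathcal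 H_n$. Moreover, the minimum of $\rho(\overline G)$ over all non-traceable graphs $G$ of order $n$ with $\delta(G)\ge k$ exists and equals $\rho(\overline{\underline{L}_n^k})$. (2) Let $k\ge 1$ and $n\ge 2k+1$. If $G$ is a graph of order $n$ with $\delta(G)\ge k$ and $\rho(\overline G)\le\rho(\overline{L_n^k})$, then $G$ is Hamiltonian if and only if it is none of the following exceptions: $G=L_n^k$, or $n=2k+1$ and $G\in\mathcal H_n$. Moreover, the minimum of $\rho(\overline G)$ over all non-Hamiltonian graphs $G$ of order $n$ with $\delta(G)\ge k$ exists and equals $\rho(\overline{L_n^k})$. -/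

import Mathlib

namespace HamSpec

/-- The largest eigenvalue of the adjacency matrix of a finite graph (see
`spectralRadius_isGreatest`: on a nonempty vertex set the supremum is attained). -/
noncomputable def spectralRadius {V : Type*} [Fintype V] (G : SimpleGraph V) : ℝ :=
  open Classical in
  sSup {μ : ℝ | Module.End.HasEigenvalue (Matrix.toLin' (G.adjMatrix ℝ)) μ}

open Classical in
theorem spectralRadius_isGreatest {V : Type*} [Fintype V] [Nonempty V] (G : SimpleGraph V) :
    IsGreatest {μ : ℝ | Module.End.HasEigenvalue (Matrix.toLin' (G.adjMatrix ℝ)) μ}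
      (spectralRadius G) := by
  have hA : (G.adjMatrix ℝ).IsHermitian := by
    ext i j
    simp [Matrix.conjTranspose_apply, SimpleGraph.adj_comm]
  have hS : {μ : ℝ | Module.End.HasEigenvalue (Matrix.toLin' (G.adjMatrix ℝ)) μ}
      = Set.range hA.eigenvalues := by
    rw [← hA.spectrum_real_eq_range_eigenvalues]
    ext μ
    rw [Set.mem_ofPred_eq, Module.End.hasEigenvalue_iff_mem_spectrum, Matrix.spectrum_toLin']
  have hfin : (Set.range hA.eigenvalues).Finite := Set.finite_range _
  have hne : (Set.range hA.eigenvalues).Nonempty := Set.range_nonempty _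
  unfold spectralRadius
  rw [hS]
  exact ⟨hne.csSup_mem hfin, fun _ hx => le_csSup hfin.bddAbove hx⟩

/-- The minimum degree `δ(G)`. -/
noncomputable def minDeg {V : Type*} [Fintype V] (G : SimpleGraph V) : ℕ :=
  open Classical in G.minDegree

/-- A graph is traceable if it contains a path through all of its vertices. -/
def IsTraceable {V : Type*} [DecidableEq V] (G : SimpleGraph V) : Prop :=
  ∃ (a b : V) (p : G.Walk a b), p.IsHamiltonian

/-- The join `G ∨ H`: the disjoint union together with all edges between the two parts. -/
def join {V W : Type*} (G : SimpleGraph V) (H : SimpleGraph W) : SimpleGraph (V ⊕ W) :=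
  SimpleGraph.sum G H ⊔ completeBipartiteGraph V W

/-- The complete graph `K_m`. -/
abbrev K (m : ℕ) : SimpleGraph (Fin m) := SimpleGraph.completeGraph (Fin m)

/-- `L_n^k = K_1 ∨ (K_k + K_{n-k-1})`, for `1 ≤ k ≤ (n-1)/2`. -/
def L (n k : ℕ) : SimpleGraph (Fin 1 ⊕ (Fin k ⊕ Fin (n - k - 1))) :=
  join (K 1) (SimpleGraph.sum (K k) (K (n - k - 1)))

/-- `K_{k+1} + K_{n-k-1}`, for `0 ≤ k ≤ n/2 - 1`. -/
def Lbar (n k : ℕ) : SimpleGraph (Fin (k + 1) ⊕ Fin (n - k - 1)) :=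
  SimpleGraph.sum (K (k + 1)) (K (n - k - 1))

/-- For `n = |V| ≥ 1`, `G` belongs to the class of the graphs with
`K_{⌈n/2⌉-1, ⌊n/2⌋+1} ⊆ G ⊆ K_{⌈n/2⌉-1} ∨ (⌊n/2⌋+1) K_1`; the bijection `e` labels the vertices
of `G` by those of the two bounding graphs, all three of which have order `n`. -/
def InH {V : Type*} [Fintype V] (G : SimpleGraph V) : Prop :=
  ∃ (a b : ℕ) (e : Fin a ⊕ Fin b ≃ V),
    a + 1 = (Fintype.card V + 1) / 2 ∧ b = Fintype.card V / 2 + 1 ∧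
    completeBipartiteGraph (Fin a) (Fin b) ≤ G.comap e ∧
    G.comap e ≤ join (K a) (⊥ : SimpleGraph (Fin b))

end HamSpec

/-!
The Hamiltonian half is the main one; the traceable half is its case of cones `K_1 ∨ G`: `G` is
traceable exactly when its cone is Hamiltonian, and coning replaces `(n, k)` by `(n + 1, k + 1)`, turns
`K_{k+1} + K_{n-k-1}` into `L_{n+1}^{k+1}` and `H_n` (for even `n`) into `H_{n+1}`, and adds only
an isolated vertex to the complement.

Let `G` be non-Hamiltonian of order `n` with minimum degree at least `k`, and let `H ⊇ G` be
edge-maximal among the non-Hamiltonian graphs. Any two non-adjacent vertices of `H` are the ends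
of a Hamiltonian path, so by Ore's exchange argument (`IsPathSeq.not_crossing`) their degrees add
up to at most `n - 1`. In the complement of `H` the end degrees of each edge thus add up to at
least `n - 1`, while no degree exceeds `n - 1 - k`; hence their product is at least
`k (n - 1 - k)`. The Rayleigh quotient of the vector `√d`, with `d` the degree function of the complement of
`H`, then shows that the spectral radius of the complement of `G` is at least `√(k (n - 1 - k))`
(`le_spectralRadius_of_deg_mul_deg`). This is the value at `L_n^k`, whose complement is
`K_{k, n-k-1}` with an isolated vertex.

In the case of equality all these products equal `k (n - 1 - k)`, so each edge of the complement
of `H` has end degrees `k` and `n - 1 - k`. If `k < n - 1 - k`, this forces the complement of `H`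
to be `K_{k, n-k-1}` with an isolated vertex (`exists_bipartition_of_deg`), and `G = H` because
`√d` is also an eigenvector for the complement of `G`. If `n = 2k + 1`, no spectral information is
needed: a non-Hamiltonian graph of order `2k + 1` and minimum degree at least `k` is `L_n^k` or
belongs to `H_n` (`hasLShape_or_hasHShape`). Indeed, along a Hamiltonian path with non-adjacent
ends, the neighbours of the first vertex either form an initial segment, which separates the graph
into two cliques sharing a vertex, or yield a cycle of length `2k`; the vertex off that cycle is
then adjacent to alternate vertices of it, and so is each vertex it can be exchanged with.
-/

namespace HamSpec

open SimpleGraph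

variable {V : Type*} [Fintype V]

/-! ### Hamiltonian cycles and paths as sequences -/

theorem zmod_val_add_one {n : ℕ} [NeZero n] {i : ZMod n} (h : i.val + 1 < n) :
    (i + 1).val = i.val + 1 := by
  have h1 : i + 1 = ((i.val + 1 : ℕ) : ZMod n) := by simp
  rw [h1, ZMod.val_cast_of_lt h]

theorem zmod_add_one_eq_zero {n : ℕ} [NeZero n] {i : ZMod n} (h : i.val + 1 = n) :
    i + 1 = 0 := by
  have h1 : i + 1 = ((i.val + 1 : ℕ) : ZMod n) := by simp
  rw [h1, h, ZMod.natCast_self]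

theorem isHamiltonian_of_zmod [DecidableEq V] {G : SimpleGraph V} {n : ℕ} (hn : 3 ≤ n)
    (hV : Fintype.card V = n)
    (q : ZMod n → V) (hq : Function.Injective q) (hadj : ∀ i, G.Adj (q i) (q (i + 1))) :
    G.IsHamiltonian := by
  obtain ⟨m, rfl⟩ : ∃ m, n = m + 3 := ⟨n - 3, by omega⟩
  have hbij : Function.Bijective q :=
    (Fintype.bijective_iff_injective_and_card q).2 ⟨hq, by rw [ZMod.card, hV]⟩
  let f : cycleGraph (m + 3) →g G :=
    { toFun := q
      map_rel' := by
        intro a b hab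
        rcases cycleGraph_adj.1 hab with h | h
        · have h' : a = b + 1 := by rw [← h]; abel
          rw [h']
          exact (hadj b).symm
        · have h' : b = a + 1 := by rw [← h]; abel
          rw [h']
          exact hadj a }
  intro _
  refine ⟨_, (cycleGraph.cycle m).map f, ?_⟩
  refine Walk.IsHamiltonianCycle.map (f := f) hbij ?_
  rw [Walk.isHamiltonianCycle_iff_isCycle_and_length_eq]
  exact ⟨cycleGraph.isCycle_cycle, by simp [cycleGraph.length_cycle]⟩

theorem IsHamiltonian.exists_zmod [DecidableEq V] {G : SimpleGraph V} {n : ℕ} (hn : 3 ≤ n)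
    (hV : Fintype.card V = n) (h : G.IsHamiltonian) :
    ∃ q : ZMod n → V, Function.Injective q ∧ ∀ i, G.Adj (q i) (q (i + 1)) := by
  obtain ⟨m, rfl⟩ : ∃ m, n = m + 3 := ⟨n - 3, by omega⟩
  obtain ⟨a, p, hp⟩ := h (by omega)
  have hlen : p.length = m + 3 := hp.length_eq.trans hV
  refine ⟨fun i => p.getVert i.val, ?_, ?_⟩
  · intro i j hij
    have hi := ZMod.val_lt i
    have hj := ZMod.val_lt j
    exact ZMod.val_injective _ (hp.isCycle.getVert_injOn' (by simp only [Set.mem_ofPred_eq]; omega)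
      (by simp only [Set.mem_ofPred_eq]; omega) hij)
  · intro i
    have hi := ZMod.val_lt i
    by_cases h : i.val + 1 < m + 3
    · simp only [zmod_val_add_one h]
      exact p.adj_getVert_succ (by omega)
    · have h1 : i.val = m + 2 := by omega
      have h2 : i + 1 = 0 := zmod_add_one_eq_zero (by omega)
      have h3 := p.adj_getVert_succ (i := m + 2) (by omega)
      rw [← hlen, p.getVert_length] at h3
      simpa [h2, h1] using h3

/-- A Hamiltonian cycle listed as a sequence indexed by `0, …, n - 1`. -/
theorem isHamiltonian_of_seq [DecidableEq V] {G : SimpleGraph V} {n : ℕ} (hn : 3 ≤ n)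
    (hV : Fintype.card V = n)
    (p : ℕ → V) (hinj : ∀ i < n, ∀ j < n, p i = p j → i = j)
    (hadj : ∀ i, i + 1 < n → G.Adj (p i) (p (i + 1))) (hlast : G.Adj (p (n - 1)) (p 0)) :
    G.IsHamiltonian := by
  obtain ⟨m, rfl⟩ : ∃ m, n = m + 3 := ⟨n - 3, by omega⟩
  refine isHamiltonian_of_zmod hn hV (fun i => p i.val) ?_ ?_
  · intro i j hij
    exact ZMod.val_injective _ (hinj _ (ZMod.val_lt i) _ (ZMod.val_lt j) hij)
  · intro i
    have hi := ZMod.val_lt i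
    by_cases h : i.val + 1 < m + 3
    · simp only [zmod_val_add_one h]
      exact hadj _ h
    · have h1 : i.val = m + 2 := by omega
      have h2 : i + 1 = 0 := zmod_add_one_eq_zero (by omega)
      simpa [h2, h1] using hlast

theorem exists_walk_support {W : Type*} {G : SimpleGraph W} (p : ℕ → W) (m : ℕ)
    (hadj : ∀ i < m, G.Adj (p i) (p (i + 1))) :
    ∃ w : G.Walk (p 0) (p m), w.support = (List.range (m + 1)).map p := by
  induction m with
  | zero => exact ⟨Walk.nil, by simp⟩
  | succ m ih =>
    obtain ⟨w, hw⟩ := ih fun i hi => hadj i (by omega)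
    refine ⟨w.concat (hadj m (by omega)), ?_⟩
    rw [Walk.support_concat, hw, List.range_succ (n := m + 1), List.map_append]
    simp

theorem isTraceable_of_seq [DecidableEq V] {G : SimpleGraph V} {n : ℕ} (hn : 1 ≤ n)
    (hV : Fintype.card V = n)
    (p : ℕ → V) (hinj : ∀ i < n, ∀ j < n, p i = p j → i = j)
    (hadj : ∀ i, i + 1 < n → G.Adj (p i) (p (i + 1))) : IsTraceable G := by
  obtain ⟨w, hw⟩ := exists_walk_support (G := G) p (n - 1) fun i hi => hadj i (by omega)
  refine ⟨_, _, w, ?_⟩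
  rw [Walk.isHamiltonian_iff_isPath_and_length_eq]
  have hlen : w.support.length = n := by rw [hw]; simp; omega
  refine ⟨?_, by rw [Walk.length_support] at hlen; omega⟩
  rw [Walk.isPath_def, hw]
  refine List.Nodup.map_on ?_ List.nodup_range
  intro i hi j hj
  simp only [List.mem_range] at hi hj
  exact hinj i (by omega) j (by omega)

theorem IsTraceable.exists_seq [DecidableEq V] {G : SimpleGraph V} {n : ℕ} (hV : Fintype.card V = n)
    (h : IsTraceable G) : ∃ p : ℕ → V, (∀ i < n, ∀ j < n, p i = p j → i = j) ∧
      ∀ i, i + 1 < n → G.Adj (p i) (p (i + 1)) := by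
  obtain ⟨a, b, w, hw⟩ := h
  have hlen := hw.length_eq
  have : 0 < Fintype.card V := Fintype.card_pos_iff.2 ⟨a⟩
  refine ⟨w.getVert, ?_, fun i hi => w.adj_getVert_succ (by omega)⟩
  intro i hi j hj hij
  exact hw.isPath.getVert_injOn (by simp only [Set.mem_ofPred_eq]; omega)
    (by simp only [Set.mem_ofPred_eq]; omega) hij

/-! ### Ore's exchange argument -/

/-- The degree of a vertex, as the cardinality of its neighbour set; unlike `SimpleGraph.degree`
it involves no decidability instance. -/
noncomputable def deg {V : Type*} (G : SimpleGraph V) (v : V) : ℕ := (G.neighborSet v).ncard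

theorem deg_mono {G H : SimpleGraph V} (h : G ≤ H) (v : V) : deg G v ≤ deg H v :=
  Set.ncard_le_ncard (fun _ hw => h hw) (Set.toFinite _)

theorem le_minDeg_iff [Nonempty V] {G : SimpleGraph V} {k : ℕ} :
    k ≤ minDeg G ↔ ∀ v, k ≤ deg G v := by
  classical
  have h : ∀ v, deg G v = G.degree v := fun v => by
    rw [deg, Set.ncard_eq_toFinset_card', ← SimpleGraph.card_neighborFinset_eq_degree]
    rfl
  constructor
  · intro hk v
    rw [h]
    refine le_trans hk ?_
    unfold minDeg
    convert G.minDegree_le_degree v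
  · intro hk
    unfold minDeg
    refine G.le_minDegree_of_forall_le_degree k fun v => ?_
    refine le_trans (hk v) (le_of_eq ?_)
    rw [h]

/-- The structure of `L_n^k`, read off inside the vertex set: a vertex `w` adjacent to all others
whose removal leaves two cliques, one of which, `S`, has `k` vertices. -/
def HasLShape {V : Type*} (G : SimpleGraph V) (k : ℕ) : Prop :=
  ∃ (w : V) (S : Set V), w ∉ S ∧ S.ncard = k ∧
    ∀ u v, G.Adj u v ↔ u ≠ v ∧ (u = w ∨ v = w ∨ (u ∈ S ↔ v ∈ S))

/-- The structure of the class `H_n`, read off inside the vertex set: an independent set of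
`⌊n/2⌋ + 1` vertices, each adjacent to every vertex outside the set. -/
def HasHShape {V : Type*} (G : SimpleGraph V) : Prop :=
  ∃ S : Set V, S.ncard = Nat.card V / 2 + 1 ∧ ∀ u ∈ S, ∀ v, G.Adj u v ↔ v ∉ S

/-- `p 0, …, p (n - 1)` is a path of `G` on `n` distinct vertices. -/
structure IsPathSeq {V : Type*} (G : SimpleGraph V) (n : ℕ) (p : ℕ → V) : Prop where
  inj : ∀ i < n, ∀ j < n, p i = p j → i = j
  adj : ∀ i, i + 1 < n → G.Adj (p i) (p (i + 1))

theorem IsPathSeq.exists_eq {G : SimpleGraph V} {n : ℕ} {p : ℕ → V} (hp : IsPathSeq G n p)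
    (hV : Fintype.card V = n) (v : V) : ∃ i < n, p i = v := by
  have hbij : Function.Bijective (fun i : Fin n => p i) := by
    refine (Fintype.bijective_iff_injective_and_card _).2 ⟨fun i j h => ?_, by simp [hV]⟩
    exact Fin.ext (hp.inj i i.2 j j.2 h)
  obtain ⟨i, hi⟩ := hbij.2 v
  exact ⟨i, i.2, hi⟩

/-- The exchange behind Ore's theorem: in a non-Hamiltonian graph, an edge from the first vertex
of a Hamiltonian path to the successor of a vertex excludes an edge from that vertex to the last
vertex of the path. -/
theorem IsPathSeq.not_crossing [DecidableEq V] {G : SimpleGraph V} {n : ℕ} {p : ℕ → V}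
    (hp : IsPathSeq G n p)
    (hn : 3 ≤ n) (hV : Fintype.card V = n) (hG : ¬ G.IsHamiltonian) {i : ℕ} (hi : i + 1 < n)
    (h0 : G.Adj (p 0) (p (i + 1))) (h1 : G.Adj (p i) (p (n - 1))) : False := by
  -- the Hamiltonian cycle `p 0, …, p i, p (n - 1), …, p (i + 1)`
  refine hG (isHamiltonian_of_seq hn hV (fun j => p (if j ≤ i then j else n + i - j)) ?_ ?_ ?_)
  · intro a ha b hb hab
    have := hp.inj _ (by split_ifs <;> omega) _ (by split_ifs <;> omega) hab
    split_ifs at this <;> omega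
  · intro j hj
    rcases lt_trichotomy j i with h | rfl | h
    · simp only [if_pos h.le, if_pos (Nat.succ_le_of_lt h)]
      exact hp.adj j hj
    · simp only [le_refl, if_true, if_neg (show ¬ j + 1 ≤ j by omega)]
      rwa [show n + j - (j + 1) = n - 1 by omega]
    · simp only [if_neg (show ¬ j ≤ i by omega), if_neg (show ¬ j + 1 ≤ i by omega)]
      have := hp.adj (n + i - (j + 1)) (by omega)
      rw [show n + i - (j + 1) + 1 = n + i - j by omega] at this
      exact this.symm
  · simp only [if_neg (show ¬ n - 1 ≤ i by omega), Nat.zero_le, if_true]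
    rw [show n + i - (n - 1) = i + 1 by omega]
    exact h0.symm

theorem IsPathSeq.deg_first {G : SimpleGraph V} {n : ℕ} {p : ℕ → V} (hp : IsPathSeq G n p)
    (hV : Fintype.card V = n) :
    deg G (p 0) = {i | i + 1 < n ∧ G.Adj (p 0) (p (i + 1))}.ncard := by
  have : G.neighborSet (p 0) =
      (fun i => p (i + 1)) '' {i | i + 1 < n ∧ G.Adj (p 0) (p (i + 1))} := by
    ext v
    simp only [mem_neighborSet, Set.mem_image, Set.mem_ofPred_eq]
    constructor
    · intro h
      obtain ⟨i, hi, rfl⟩ := hp.exists_eq hV v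
      obtain ⟨j, rfl⟩ : ∃ j, i = j + 1 := Nat.exists_eq_succ_of_ne_zero (by
        rintro rfl
        exact G.irrefl h)
      exact ⟨j, ⟨hi, h⟩, rfl⟩
    · rintro ⟨i, ⟨-, h⟩, rfl⟩
      exact h
  rw [deg, this, Set.InjOn.ncard_image]
  intro i hi j hj hij
  have := hp.inj _ hi.1 _ hj.1 hij
  omega

theorem IsPathSeq.deg_last {G : SimpleGraph V} {n : ℕ} {p : ℕ → V} (hp : IsPathSeq G n p)
    (hV : Fintype.card V = n) :
    deg G (p (n - 1)) = {i | i + 1 < n ∧ G.Adj (p i) (p (n - 1))}.ncard := by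
  have : G.neighborSet (p (n - 1)) = p '' {i | i + 1 < n ∧ G.Adj (p i) (p (n - 1))} := by
    ext v
    simp only [mem_neighborSet, Set.mem_image, Set.mem_ofPred_eq]
    constructor
    · intro h
      obtain ⟨i, hi, rfl⟩ := hp.exists_eq hV v
      refine ⟨i, ⟨?_, h.symm⟩, rfl⟩
      by_contra hc
      have : i = n - 1 := by omega
      subst this
      exact G.irrefl h
    · rintro ⟨i, ⟨-, h⟩, rfl⟩
      exact h.symm
  rw [deg, this, Set.InjOn.ncard_image]
  intro i hi j hj hij
  exact hp.inj _ (by have := hi.1; omega) _ (by have := hj.1; omega) hij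

theorem ncard_succ_lt (n : ℕ) : {i | i + 1 < n}.ncard = n - 1 := by
  have : {i | i + 1 < n} = Set.Iio (n - 1) := by
    ext i
    simp only [Set.mem_ofPred_eq, Set.mem_Iio]
    omega
  rw [this, Set.ncard_Iio_nat]

theorem IsPathSeq.ncard_union [DecidableEq V] {G : SimpleGraph V} {n : ℕ} {p : ℕ → V}
    (hp : IsPathSeq G n p)
    (hn : 3 ≤ n) (hV : Fintype.card V = n) (hG : ¬ G.IsHamiltonian) :
    ({i | i + 1 < n ∧ G.Adj (p 0) (p (i + 1))} ∪ {i | i + 1 < n ∧ G.Adj (p i) (p (n - 1))}).ncard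
      = deg G (p 0) + deg G (p (n - 1)) := by
  have hf : {i | i + 1 < n}.Finite := (Set.finite_Iio n).subset fun i hi => by
    simp only [Set.mem_ofPred_eq] at hi
    exact Set.mem_Iio.2 (by omega)
  rw [hp.deg_first hV, hp.deg_last hV, Set.ncard_union_eq ?_ (hf.subset fun i hi => hi.1)
    (hf.subset fun i hi => hi.1)]
  rw [Set.disjoint_left]
  rintro i ⟨hi, h0⟩ ⟨-, h1⟩
  exact hp.not_crossing hn hV hG hi h0 h1

theorem IsPathSeq.deg_add_deg_le [DecidableEq V] {G : SimpleGraph V} {n : ℕ} {p : ℕ → V}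
    (hp : IsPathSeq G n p)
    (hn : 3 ≤ n) (hV : Fintype.card V = n) (hG : ¬ G.IsHamiltonian) :
    deg G (p 0) + deg G (p (n - 1)) ≤ n - 1 := by
  have hf : {i | i + 1 < n}.Finite := (Set.finite_Iio n).subset fun i hi => by
    simp only [Set.mem_ofPred_eq] at hi
    exact Set.mem_Iio.2 (by omega)
  rw [← hp.ncard_union hn hV hG, ← ncard_succ_lt n]
  exact Set.ncard_le_ncard (Set.union_subset (fun i hi => hi.1) (fun i hi => hi.1)) hf

/-- If the degrees of the two ends of a Hamiltonian path add up to at least `n - 1`, the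
exchange condition of `IsPathSeq.not_crossing` is met with equality at each position. -/
theorem IsPathSeq.adj_or_adj [DecidableEq V] {G : SimpleGraph V} {n : ℕ} {p : ℕ → V}
    (hp : IsPathSeq G n p)
    (hn : 3 ≤ n) (hV : Fintype.card V = n) (hG : ¬ G.IsHamiltonian)
    (hd : n - 1 ≤ deg G (p 0) + deg G (p (n - 1))) {i : ℕ} (hi : i + 1 < n) :
    G.Adj (p 0) (p (i + 1)) ∨ G.Adj (p i) (p (n - 1)) := by
  have hf : {i | i + 1 < n}.Finite := (Set.finite_Iio n).subset fun i hi => by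
    simp only [Set.mem_ofPred_eq] at hi
    exact Set.mem_Iio.2 (by omega)
  have h := Set.eq_of_subset_of_ncard_le
    (Set.union_subset (fun i hi => hi.1) (fun i hi => hi.1) :
      {i | i + 1 < n ∧ G.Adj (p 0) (p (i + 1))} ∪ {i | i + 1 < n ∧ G.Adj (p i) (p (n - 1))}
        ⊆ {i | i + 1 < n})
    (by rw [hp.ncard_union hn hV hG, ncard_succ_lt]; exact hd) hf
  have hi' : i ∈ {i | i + 1 < n} := hi
  rw [← h] at hi'
  exact hi'.imp And.right And.right

/-- In an edge-maximal non-Hamiltonian graph any two non-adjacent vertices are the ends of a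
Hamiltonian path. -/
theorem exists_isPathSeq_of_maximal [DecidableEq V] {H : SimpleGraph V} {n : ℕ} (hn : 3 ≤ n)
    (hV : Fintype.card V = n) (hH : Maximal (fun G : SimpleGraph V => ¬ G.IsHamiltonian) H)
    {u v : V} (huv : u ≠ v) (hadj : ¬ H.Adj u v) :
    ∃ p, IsPathSeq H n p ∧ ((p 0 = u ∧ p (n - 1) = v) ∨ (p 0 = v ∧ p (n - 1) = u)) := by
  have hham : (H ⊔ edge u v).IsHamiltonian := by
    by_contra hc
    have := hH.2 hc le_sup_left
    exact hadj (this (Or.inr (by simp [edge_adj, huv])))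
  obtain ⟨q, hq, hqa⟩ := IsHamiltonian.exists_zmod hn hV hham
  obtain ⟨i, hi⟩ : ∃ i, ¬ H.Adj (q i) (q (i + 1)) := by
    by_contra! hc
    exact hH.1 (isHamiltonian_of_zmod hn hV q hq hc)
  have key : ∀ j, ¬ H.Adj (q j) (q (j + 1)) →
      (q j = u ∧ q (j + 1) = v) ∨ (q j = v ∧ q (j + 1) = u) := by
    intro j hj
    have := hqa j
    simp only [sup_adj, hj, false_or, edge_adj] at this
    exact this.1
  have hcast : ∀ m : ℕ, ((m : ZMod n) = 0) → m < n → m = 0 := by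
    intro m hm hmn
    exact Nat.eq_zero_of_dvd_of_lt ((ZMod.natCast_eq_zero_iff m n).1 hm) hmn
  have hp0 : q (i + 1 + ((0 : ℕ) : ZMod n)) = q (i + 1) := by simp
  have hpn : q (i + 1 + ((n - 1 : ℕ) : ZMod n)) = q i := by
    congr 1
    have : ((n - 1 : ℕ) : ZMod n) + 1 = 0 := by
      rw [Nat.cast_sub (by omega), ZMod.natCast_self]
      simp
    linear_combination this
  refine ⟨fun m => q (i + 1 + (m : ZMod n)), ⟨?_, ?_⟩, ?_⟩
  · intro a ha b hb hab
    have h1 := add_left_cancel (hq hab)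
    have := (ZMod.natCast_eq_natCast_iff' a b n).1 h1
    rwa [Nat.mod_eq_of_lt ha, Nat.mod_eq_of_lt hb] at this
  · intro m hm
    by_contra hc
    push_cast at hc
    rw [← add_assoc] at hc
    -- the only missing edge of the cycle is `q i — q (i + 1)`, which the path does not use
    have hsame : q (i + 1 + (m : ZMod n)) = q i ∨
        (q (i + 1 + (m : ZMod n)) = q (i + 1) ∧ q (i + 1 + (m : ZMod n) + 1) = q i) := by
      rcases key _ hc with ⟨h1, h2⟩ | ⟨h1, h2⟩ <;> rcases key _ hi with ⟨h3, h4⟩ | ⟨h3, h4⟩ <;>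
        simp [h1, h2, h3, h4]
    rcases hsame with h | ⟨h, h'⟩
    · have h1 : ((m + 1 : ℕ) : ZMod n) = 0 := by
        push_cast
        linear_combination hq h
      have := hcast _ h1 (by omega)
      omega
    · have h1 : ((2 : ℕ) : ZMod n) = 0 := by
        push_cast
        linear_combination hq h' - hq h
      have := hcast _ h1 (by omega)
      omega
  · simp only [hp0, hpn]
    rcases key i hi with ⟨h1, h2⟩ | ⟨h1, h2⟩ <;> simp [h1, h2]

theorem isHamiltonian_top [DecidableEq V] {n : ℕ} (hn : 3 ≤ n) (hV : Fintype.card V = n) :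
    (⊤ : SimpleGraph V).IsHamiltonian := by
  have : NeZero n := ⟨by omega⟩
  have : Nontrivial (ZMod n) := ZMod.nontrivial_iff.2 (by omega)
  have e : ZMod n ≃ V := Fintype.equivOfCardEq (by rw [ZMod.card, hV])
  refine isHamiltonian_of_zmod hn hV e e.injective fun i => ?_
  simp

/-- Ore's condition for edge-maximal non-Hamiltonian graphs. -/
theorem deg_add_deg_le_of_maximal [DecidableEq V] {H : SimpleGraph V} {n : ℕ} (hn : 3 ≤ n)
    (hV : Fintype.card V = n) (hH : Maximal (fun G : SimpleGraph V => ¬ G.IsHamiltonian) H)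
    {u v : V} (huv : u ≠ v) (hadj : ¬ H.Adj u v) : deg H u + deg H v ≤ n - 1 := by
  obtain ⟨p, hp, h⟩ := exists_isPathSeq_of_maximal hn hV hH huv hadj
  have := hp.deg_add_deg_le hn hV hH.1
  rcases h with ⟨h1, h2⟩ | ⟨h1, h2⟩ <;> rw [h1, h2] at this <;> omega

theorem exists_not_adj_of_not_isHamiltonian [DecidableEq V] {H : SimpleGraph V} {n : ℕ} (hn : 3 ≤ n)
    (hV : Fintype.card V = n) (hH : ¬ H.IsHamiltonian) : ∃ u v, u ≠ v ∧ ¬ H.Adj u v := by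
  by_contra! hc
  refine hH ?_
  have : H = ⊤ := by
    ext u v
    exact ⟨fun h => h.ne, fun h => hc u v h⟩
  rw [this]
  exact isHamiltonian_top hn hV

/-! ### Order `2k + 1` and minimum degree `k` -/

theorem eq_or_exists_of_injective {m : ℕ} [NeZero m] (hV : Fintype.card V = m + 1)
    {c : ZMod m → V} (hc : Function.Injective c) {u : V} (hu : ∀ i, c i ≠ u) (v : V) :
    v = u ∨ ∃ i, c i = v := by
  have hinj : Function.Injective (fun o : Option (ZMod m) => o.elim u c) := by
    rintro (_ | i) (_ | j) h
    all_goals simp only [Option.elim] at h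
    · rfl
    · exact absurd h.symm (hu j)
    · exact absurd h (hu i)
    · rw [hc h]
  obtain ⟨o, ho⟩ := ((Fintype.bijective_iff_injective_and_card _).2
    ⟨hinj, by rw [Fintype.card_option, ZMod.card, hV]⟩).2 v
  rcases o with _ | i
  · exact Or.inl ho.symm
  · exact Or.inr ⟨i, ho⟩

/-- A vertex `u` off a cycle through all the other `2k` vertices of a non-Hamiltonian graph, of
degree at least `k`, is adjacent to alternate vertices of the cycle: two consecutive neighbours
would allow inserting `u`. -/
theorem adj_alternate [DecidableEq V] {G : SimpleGraph V} {k : ℕ} (hk : 1 ≤ k)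
    (hV : Fintype.card V = 2 * k + 1) (hG : ¬ G.IsHamiltonian) {c : ZMod (2 * k) → V}
    (hc : Function.Injective c) (hadj : ∀ i, G.Adj (c i) (c (i + 1))) {u : V}
    (hu : ∀ i, c i ≠ u) (hd : k ≤ deg G u) :
    deg G u = k ∧ ∀ i, G.Adj u (c (i + 1)) ↔ ¬ G.Adj u (c i) := by
  have : NeZero (2 * k) := ⟨by omega⟩
  have hsurj := eq_or_exists_of_injective hV hc hu
  have hnot : ∀ i, G.Adj u (c i) → ¬ G.Adj u (c (i + 1)) := by
    intro i h0 h1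
    refine hG (isHamiltonian_of_seq (n := 2 * k + 1) (by omega) hV
      (fun m => if m < 2 * k then c (i + 1 + (m : ZMod (2 * k))) else u) ?_ ?_ ?_)
    · intro a ha b hb hab
      split_ifs at hab with h2 h3 h3
      · have := (ZMod.natCast_eq_natCast_iff' a b _).1 (add_left_cancel (hc hab))
        rwa [Nat.mod_eq_of_lt h2, Nat.mod_eq_of_lt h3] at this
      · exact absurd hab (hu _)
      · exact absurd hab.symm (hu _)
      · omega
    · intro m hm
      by_cases h2 : m + 1 < 2 * k
      · simp only [if_pos h2, if_pos (show m < 2 * k by omega)]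
        push_cast
        rw [← add_assoc]
        exact hadj _
      · simp only [if_neg h2, if_pos (show m < 2 * k by omega)]
        have h3 : (m : ZMod (2 * k)) + 1 = 0 := by
          have h4 : m + 1 = 2 * k := by omega
          have := ZMod.natCast_self (2 * k)
          rw [← h4] at this
          rw [← h4]
          exact_mod_cast this
        rw [show i + 1 + (m : ZMod (2 * k)) = i by linear_combination h3]
        exact h0.symm
    · simp only [show ¬ (2 * k + 1 - 1 < 2 * k) by omega, if_false,
        if_pos (show 0 < 2 * k by omega), Nat.cast_zero, add_zero]
      exact h1
  set N : Set (ZMod (2 * k)) := {i | G.Adj u (c i)} with hN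
  have hdeg : deg G u = N.ncard := by
    have : G.neighborSet u = c '' N := by
      ext v
      simp only [mem_neighborSet, Set.mem_image, hN, Set.mem_ofPred_eq]
      constructor
      · intro h
        obtain ⟨i, rfl⟩ := (hsurj v).resolve_left h.ne'
        exact ⟨i, h, rfl⟩
      · rintro ⟨i, h, rfl⟩
        exact h
    rw [deg, this, Set.ncard_image_of_injective _ hc]
  set N' : Set (ZMod (2 * k)) := (fun i => i + 1) '' N
  have hcard' : N'.ncard = N.ncard :=
    Set.ncard_image_of_injective _ (add_left_injective 1)
  have hdisj : Disjoint N N' := by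
    rw [Set.disjoint_left]
    rintro _ h ⟨i, hi, rfl⟩
    exact hnot i hi h
  have hunion : (N ∪ N').ncard = N.ncard + N.ncard := by
    rw [Set.ncard_union_eq hdisj (Set.toFinite _) (Set.toFinite _), hcard']
  have huniv : (Set.univ : Set (ZMod (2 * k))).ncard = 2 * k := by
    rw [Set.ncard_univ, Nat.card_eq_fintype_card, ZMod.card]
  have hle : (N ∪ N').ncard ≤ 2 * k := by
    exact (Set.ncard_le_ncard (Set.subset_univ _) (Set.toFinite _)).trans_eq huniv
  have heq : N ∪ N' = Set.univ :=
    Set.eq_of_subset_of_ncard_le (Set.subset_univ _) (by omega) (Set.toFinite _)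
  refine ⟨by omega, fun i => ⟨fun h h' => hnot i h' h, fun h => ?_⟩⟩
  have hi : i + 1 ∈ N ∪ N' := heq ▸ Set.mem_univ _
  rcases hi with hi | ⟨j, hj, hji⟩
  · exact hi
  · exact absurd (add_right_cancel hji ▸ hj) h

/-- A non-Hamiltonian graph of order `2k + 1` and minimum degree at least `k` with a cycle of
length `2k` has the shape of the class `H_n`. Exchanging the vertex `u` off the cycle with any
non-neighbour of `u` gives another such cycle, so all non-neighbours of `u` have the same
neighbours as `u`. -/
theorem hasHShape_of_cycle [DecidableEq V] {G : SimpleGraph V} {k : ℕ} (hk : 1 ≤ k)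
    (hV : Fintype.card V = 2 * k + 1) (hG : ¬ G.IsHamiltonian) (hd : ∀ v, k ≤ deg G v)
    {c : ZMod (2 * k) → V} (hc : Function.Injective c) (hadj : ∀ i, G.Adj (c i) (c (i + 1)))
    {u : V} (hu : ∀ i, c i ≠ u) : HasHShape G := by
  have : NeZero (2 * k) := ⟨by omega⟩
  have : Nontrivial (ZMod (2 * k)) := ZMod.nontrivial_iff.2 (by omega)
  obtain ⟨hdu, halt⟩ := adj_alternate hk hV hG hc hadj hu (hd u)
  have hsurj := eq_or_exists_of_injective hV hc hu
  have hsame : ∀ j, ¬ G.Adj u (c j) → ∀ i, G.Adj (c j) (c i) ↔ G.Adj u (c i) := by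
    intro j hj
    set c' : ZMod (2 * k) → V := Function.update c j u with hc'
    have hcj : c' j = u := by simp [hc']
    have hcne : ∀ i, i ≠ j → c' i = c i := fun i hi => by simp [hc', hi]
    have hinj' : Function.Injective c' := by
      intro a b hab
      by_cases ha : a = j <;> by_cases hb : b = j
      · rw [ha, hb]
      · rw [ha, hcj, hcne b hb] at hab
        exact absurd hab.symm (hu b)
      · rw [hb, hcj, hcne a ha] at hab
        exact absurd hab (hu a)
      · rw [hcne a ha, hcne b hb] at hab
        exact hc hab
    have hadj' : ∀ i, G.Adj (c' i) (c' (i + 1)) := by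
      intro i
      by_cases hi : i = j
      · subst hi
        rw [hcj, hcne _ (by simp)]
        exact (halt i).2 hj
      · by_cases hi' : i + 1 = j
        · rw [hi', hcj, hcne _ hi]
          by_contra hcon
          exact hj (hi' ▸ (halt i).2 fun h => hcon h.symm)
        · rw [hcne _ hi, hcne _ hi']
          exact hadj i
    have hu' : ∀ i, c' i ≠ c j := by
      intro i
      by_cases hi : i = j
      · rw [hi, hcj]
        exact (hu j).symm
      · rw [hcne i hi]
        exact fun h => hi (hc h)
    obtain ⟨-, halt'⟩ := adj_alternate hk hV hG hinj' hadj' hu' (hd (c j))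
    -- both adjacency patterns alternate along the cycle and agree at position `j`
    have hind : ∀ m : ℕ, G.Adj (c j) (c' (j + m)) ↔ G.Adj u (c (j + m)) := by
      intro m
      induction m with
      | zero =>
        simp only [Nat.cast_zero, add_zero, hcj]
        exact ⟨fun h => absurd h.symm hj, fun h => absurd h hj⟩
      | succ m ih =>
        push_cast
        rw [← add_assoc, halt', halt, ih]
    intro i
    by_cases hi : i = j
    · rw [hi]
      exact ⟨fun h => absurd h (G.irrefl), fun h => absurd h hj⟩
    · have := hind (i - j).val
      rw [ZMod.natCast_zmod_val, add_sub_cancel, hcne i hi] at this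
      exact this
  refine ⟨{v | ¬ G.Adj u v}, ?_, ?_⟩
  · have h1 : {v | ¬ G.Adj u v} = (G.neighborSet u)ᶜ := rfl
    rw [h1, Set.ncard_compl, Nat.card_eq_fintype_card, hV]
    have : (G.neighborSet u).ncard = k := hdu
    omega
  · intro s hs v
    simp only [Set.mem_ofPred_eq, not_not] at hs ⊢
    rcases hsurj s with rfl | ⟨j, rfl⟩
    · rfl
    · rcases hsurj v with rfl | ⟨i, rfl⟩
      · exact ⟨fun h => absurd h.symm hs, fun h => absurd h G.irrefl⟩
      · exact hsame j hs i

theorem adj_iff_of_neighborSet_subset {G : SimpleGraph V} {s : V} {T : Set V}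
    (h : G.neighborSet s ⊆ T) (hd : T.ncard ≤ deg G s) (v : V) : G.Adj s v ↔ v ∈ T := by
  rw [← Set.eq_of_subset_of_ncard_le h hd (Set.toFinite _)]
  rfl

theorem HasHShape.of_le {G H : SimpleGraph V} {k : ℕ} (hV : Fintype.card V = 2 * k + 1)
    (hGH : G ≤ H) (hd : ∀ v, k ≤ deg G v) (h : HasHShape H) : HasHShape G := by
  obtain ⟨S, hS, hadj⟩ := h
  refine ⟨S, hS, fun s hs => adj_iff_of_neighborSet_subset (T := Sᶜ) ?_ ?_⟩
  · intro v hv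
    exact (hadj s hs v).1 (hGH hv)
  · refine le_trans ?_ (hd s)
    rw [Set.ncard_compl, hS, Nat.card_eq_fintype_card, hV]
    omega

/-- A vertex set of size `k` with at most one neighbour `w` outside is a clique joined to `w` if
the degrees are at least `k`. -/
theorem adj_iff_of_neighborSet_subset_insert {G : SimpleGraph V} {k : ℕ} (hd : ∀ v, k ≤ deg G v)
    {w : V} {S : Set V} (hw : w ∉ S) (hS : S.ncard = k)
    (h : ∀ s ∈ S, G.neighborSet s ⊆ insert w S) {s : V} (hs : s ∈ S) (v : V) :
    G.Adj s v ↔ s ≠ v ∧ (v = w ∨ v ∈ S) := by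
  have hcard : (insert w S \ {s}).ncard = k := by
    rw [Set.ncard_sdiff_singleton_of_mem (Set.mem_insert_of_mem _ hs),
      Set.ncard_insert_of_notMem hw (Set.toFinite _), hS]
    rfl
  rw [adj_iff_of_neighborSet_subset (T := insert w S \ {s}) ?_ (by rw [hcard]; exact hd s)]
  · simp only [Set.mem_sdiff, Set.mem_insert_iff, Set.mem_singleton_iff, ne_eq]
    tauto
  · intro v hv
    exact ⟨h s hs hv, fun hvs => G.irrefl ((Set.mem_singleton_iff.1 hvs) ▸ hv : G.Adj s s)⟩

theorem hasLShape_of_separation {G : SimpleGraph V} {k : ℕ} (hV : Fintype.card V = 2 * k + 1)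
    (hd : ∀ v, k ≤ deg G v) {w : V} {S : Set V} (hw : w ∉ S) (hS : S.ncard = k)
    (hsep : ∀ s ∈ S, ∀ t, t ∉ S → t ≠ w → ¬ G.Adj s t) : HasLShape G k := by
  have hT : (insert w S)ᶜ.ncard = k := by
    rw [Set.ncard_compl, Set.ncard_insert_of_notMem hw (Set.toFinite _), hS,
      Nat.card_eq_fintype_card, hV]
    omega
  have h1 := fun (s : V) (hs : s ∈ S) => adj_iff_of_neighborSet_subset_insert hd hw hS
    (fun s hs v hv => by
      by_contra hc
      simp only [Set.mem_insert_iff, not_or] at hc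
      exact hsep s hs v hc.2 hc.1 hv) hs
  have h2 := fun (s : V) (hs : s ∈ (insert w S)ᶜ) => adj_iff_of_neighborSet_subset_insert hd
    (w := w) (by simp) hT
    (fun s hs v hv => by
      simp only [Set.mem_compl_iff, Set.mem_insert_iff, not_or] at hs ⊢
      by_contra hc
      push Not at hc
      exact hsep v (hc.2 hc.1) s hs.2 hs.1 hv.symm) hs
  simp only [Set.mem_compl_iff, Set.mem_insert_iff, not_or] at h2
  refine ⟨w, S, hw, hS, fun a b => ?_⟩
  by_cases ha : a = w
  · subst ha
    by_cases hb : b = a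
    · simp [hb]
    · rw [G.adj_comm]
      by_cases hbS : b ∈ S
      · rw [h1 b hbS]
        tauto
      · rw [h2 b ⟨hb, hbS⟩]
        tauto
  · by_cases haS : a ∈ S
    · rw [h1 a haS]
      tauto
    · rw [h2 a ⟨ha, haS⟩]
      tauto

/-- The extremal case of Dirac's theorem just below its degree bound. -/
theorem hasLShape_or_hasHShape [DecidableEq V] {G : SimpleGraph V} {k : ℕ} (hk : 1 ≤ k)
    (hV : Fintype.card V = 2 * k + 1) (hG : ¬ G.IsHamiltonian) (hd : ∀ v, k ≤ deg G v) :
    HasLShape G k ∨ HasHShape G := by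
  have hn : 3 ≤ 2 * k + 1 := by omega
  obtain ⟨H, hGH, hH⟩ := Finite.exists_le_maximal
    (p := fun G : SimpleGraph V => ¬ G.IsHamiltonian) hG
  have hdH : ∀ v, k ≤ deg H v := fun v => (hd v).trans (deg_mono hGH v)
  obtain ⟨u, v, huv, hadj⟩ := exists_not_adj_of_not_isHamiltonian hn hV hH.1
  obtain ⟨p, hp, -⟩ := exists_isPathSeq_of_maximal hn hV hH huv hadj
  have hle := hp.deg_add_deg_le hn hV hH.1
  have h0 := hdH (p 0)
  have h1 := hdH (p (2 * k + 1 - 1))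
  have hor := fun i (hi : i + 1 < 2 * k + 1) =>
    hp.adj_or_adj hn hV hH.1 (by omega) hi
  have hcross := fun i (hi : i + 1 < 2 * k + 1) => hp.not_crossing hn hV hH.1 hi
  have hfirst := hp.deg_first hV
  rw [show 2 * k + 1 - 1 = 2 * k by omega] at *
  by_cases hinit : ∀ i, 1 ≤ i → i + 1 < 2 * k + 1 → H.Adj (p 0) (p (i + 1)) → H.Adj (p 0) (p i)
  · left
    have hX : {i | i + 1 < 2 * k + 1 ∧ H.Adj (p 0) (p (i + 1))} = Set.Iio k := by
      have hdown : ∀ d i, i + d + 1 < 2 * k + 1 → H.Adj (p 0) (p (i + d + 1)) →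
          H.Adj (p 0) (p (i + 1)) := by
        intro d
        induction d with
        | zero => exact fun i _ h => h
        | succ d ih =>
          intro i hi h
          exact ih i (by omega) (hinit _ (by omega) (by omega) h)
      refine Set.eq_of_subset_of_ncard_le ?_ ?_ (Set.finite_Iio k)
      · rintro i ⟨hi, hia⟩
        have hsub : Set.Iio (i + 1) ⊆ {i | i + 1 < 2 * k + 1 ∧ H.Adj (p 0) (p (i + 1))} := by
          intro j hj
          rw [Set.mem_Iio] at hj
          refine ⟨by omega, hdown (i - j) j (by omega) ?_⟩
          rwa [show j + (i - j) + 1 = i + 1 by omega]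
        have := Set.ncard_le_ncard hsub ((Set.finite_Iio (2 * k)).subset fun j hj => by
          have := hj.1
          exact Set.mem_Iio.2 (by omega))
        rw [Set.ncard_Iio_nat, ← hfirst] at this
        exact Set.mem_Iio.2 (by omega)
      · rw [Set.ncard_Iio_nat, ← hfirst]
        exact h0
    have hA : ∀ i, i < k → H.Adj (p 0) (p (i + 1)) := fun i hi =>
      ((Set.ext_iff.1 hX i).2 hi).2
    have hB : ∀ i, k ≤ i → i < 2 * k → H.Adj (p i) (p (2 * k)) := by
      intro i hi hi2
      refine (hor i (by omega)).resolve_left fun h => ?_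
      have := (Set.ext_iff.1 hX i).1 ⟨by omega, h⟩
      rw [Set.mem_Iio] at this
      omega
    refine hasLShape_of_separation (w := p k) (S := p '' Set.Iio k) hV hd ?_ ?_ ?_
    · rintro ⟨i, hi, hik⟩
      rw [Set.mem_Iio] at hi
      have := hp.inj i (by omega) k (by omega) hik
      omega
    · rw [Set.InjOn.ncard_image, Set.ncard_Iio_nat]
      intro i hi j hj hij
      rw [Set.mem_Iio] at hi hj
      exact hp.inj i (by omega) j (by omega) hij
    · rintro _ ⟨j, hj, rfl⟩ t htS htw hjt
      rw [Set.mem_Iio] at hj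
      obtain ⟨l, hl, rfl⟩ := hp.exists_eq hV t
      have hkl : k < l := by
        by_contra hc
        rcases (show l < k ∨ l = k by omega) with h | h
        · exact htS ⟨l, h, rfl⟩
        · exact htw (by rw [h])
      have hjl := hGH hjt
      -- the Hamiltonian cycle `p j, …, p 0, p (j + 1), …, p (l - 1), p (2k), …, p l`
      refine hH.1 (isHamiltonian_of_seq hn hV
        (fun m => p (if m ≤ j then j - m else if m < l then m else 2 * k + l - m)) ?_ ?_ ?_)
      · intro a ha b hb hab
        have := hp.inj _ (by split_ifs <;> omega) _ (by split_ifs <;> omega) hab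
        split_ifs at this <;> omega
      · intro m hm
        rcases lt_trichotomy m j with h | rfl | h
        · simp only [if_pos h.le, if_pos (Nat.succ_le_of_lt h)]
          have := hp.adj (j - (m + 1)) (by omega)
          rw [show j - (m + 1) + 1 = j - m by omega] at this
          exact this.symm
        · simp only [le_refl, if_true, if_neg (show ¬ m + 1 ≤ m by omega),
            if_pos (show m + 1 < l by omega), Nat.sub_self]
          exact hA m hj
        · simp only [if_neg (show ¬ m ≤ j by omega), if_neg (show ¬ m + 1 ≤ j by omega)]
          rcases lt_trichotomy (m + 1) l with h' | h' | h'
          · rw [if_pos (show m < l by omega), if_pos h']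
            exact hp.adj m (by omega)
          · rw [if_pos (show m < l by omega), if_neg (show ¬ m + 1 < l by omega),
              show 2 * k + l - (m + 1) = 2 * k by omega]
            exact hB m (by omega) (by omega)
          · rw [if_neg (show ¬ m < l by omega), if_neg (show ¬ m + 1 < l by omega)]
            have := hp.adj (2 * k + l - (m + 1)) (by omega)
            rw [show 2 * k + l - (m + 1) + 1 = 2 * k + l - m by omega] at this
            exact this.symm
      · simp only [if_neg (show ¬ 2 * k + 1 - 1 ≤ j by omega),
          if_neg (show ¬ 2 * k + 1 - 1 < l by omega), Nat.zero_le, if_true, Nat.sub_zero]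
        rw [show 2 * k + l - (2 * k + 1 - 1) = l by omega]
        exact hjl.symm
  · right
    push Not at hinit
    obtain ⟨i, hi1, hi2, hadj1, hadj0⟩ := hinit
    obtain ⟨i, rfl⟩ : ∃ j, i = j + 1 := ⟨i - 1, by omega⟩
    have hlast := (hor i (by omega)).resolve_left hadj0
    -- the cycle `p 0, …, p i, p (2k), p (2k - 1), …, p (i + 2)` misses `p (i + 1)` only
    have : NeZero (2 * k) := ⟨by omega⟩
    have hidx : ∀ m < 2 * k, (if m ≤ i then m else 2 * k + (i + 1) - m) < 2 * k + 1 := by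
      intro m hm
      split_ifs <;> omega
    refine (hasHShape_of_cycle hk hV hH.1 hdH (u := p (i + 1)) (c := fun m =>
      p (if m.val ≤ i then m.val else 2 * k + (i + 1) - m.val)) ?_ ?_ ?_).of_le hV hGH hd
    · intro a b hab
      have ha := ZMod.val_lt a
      have hb := ZMod.val_lt b
      have := hp.inj _ (hidx _ ha) _ (hidx _ hb) hab
      refine ZMod.val_injective _ ?_
      split_ifs at this <;> omega
    · intro a
      have ha := ZMod.val_lt a
      by_cases h : a.val + 1 < 2 * k
      · simp only [zmod_val_add_one h]
        rcases lt_trichotomy a.val i with h' | h' | h'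
        · rw [if_pos h'.le, if_pos (Nat.succ_le_of_lt h')]
          exact hp.adj _ (by omega)
        · rw [if_pos h'.le, if_neg (show ¬ a.val + 1 ≤ i by omega), h',
            show 2 * k + (i + 1) - (i + 1) = 2 * k by omega]
          exact hlast
        · rw [if_neg (show ¬ a.val ≤ i by omega), if_neg (show ¬ a.val + 1 ≤ i by omega)]
          have := hp.adj (2 * k + (i + 1) - (a.val + 1)) (by omega)
          rw [show 2 * k + (i + 1) - (a.val + 1) + 1 = 2 * k + (i + 1) - a.val by omega] at this
          exact this.symm
      · simp only [zmod_add_one_eq_zero (show a.val + 1 = 2 * k by omega), ZMod.val_zero,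
          Nat.zero_le, if_true]
        rw [if_neg (show ¬ a.val ≤ i by omega),
          show 2 * k + (i + 1) - a.val = i + 1 + 1 by omega]
        exact hadj1.symm
    · intro a hab
      have ha := ZMod.val_lt a
      have := hp.inj _ (hidx _ ha) _ (by omega) hab
      split_ifs at this <;> omega

/-! ### Spectral bounds -/

open Classical in
/-- The action of the adjacency matrix of `G` on a vector `x`: the sum of `x` over the neighbours
of a vertex. -/
noncomputable def adjSum (G : SimpleGraph V) (x : V → ℝ) (u : V) : ℝ :=
  ∑ v, if G.Adj u v then x v else 0

open Classical in
theorem adjMatrix_mulVec_eq_adjSum (G : SimpleGraph V) (x : V → ℝ) :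
    (G.adjMatrix ℝ).mulVec x = adjSum G x := by
  funext u
  simp [Matrix.mulVec, dotProduct, adjSum, adjMatrix_apply]

open Classical in
theorem posSemidef_spectralRadius_sub (G : SimpleGraph V) [Nonempty V] :
    (spectralRadius G • (1 : Matrix V V ℝ) - G.adjMatrix ℝ).PosSemidef := by
  have hM : (spectralRadius G • (1 : Matrix V V ℝ) - G.adjMatrix ℝ).IsHermitian := by
    ext i j
    simp [Matrix.conjTranspose_apply, adj_comm, Matrix.one_apply, eq_comm]
  rw [hM.posSemidef_iff_eigenvalues_nonneg]
  intro i
  set μ := hM.eigenvalues i with hμ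
  have hv := hM.mulVec_eigenvectorBasis i
  set v : V → ℝ := ⇑(hM.eigenvectorBasis i) with hvdef
  have hv0 : v ≠ 0 := by
    intro h
    refine (hM.eigenvectorBasis.toBasis.ne_zero i) ?_
    ext j
    simpa using congrFun h j
  have hA : (G.adjMatrix ℝ).mulVec v = (spectralRadius G - μ) • v := by
    rw [Matrix.sub_mulVec, Matrix.smul_mulVec, Matrix.one_mulVec] at hv
    rw [sub_smul, hμ, ← hv]
    abel
  have hev : Module.End.HasEigenvalue (Matrix.toLin' (G.adjMatrix ℝ)) (spectralRadius G - μ) := by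
    refine Module.End.hasEigenvalue_of_hasEigenvector (x := v) ⟨?_, hv0⟩
    rw [Module.End.mem_eigenspace_iff, Matrix.toLin'_apply]
    exact hA
  have := (spectralRadius_isGreatest G).2 hev
  change (0 : ℝ) ≤ μ
  linarith

theorem sum_mul_adjSum_le [Nonempty V] (G : SimpleGraph V) (x : V → ℝ) :
    ∑ u, x u * adjSum G x u ≤ spectralRadius G * ∑ u, x u ^ 2 := by
  classical
  have h := (posSemidef_spectralRadius_sub G).dotProduct_mulVec_nonneg x
  rw [Matrix.sub_mulVec, Matrix.smul_mulVec, Matrix.one_mulVec, dotProduct_sub, star_trivial] at h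
  have h1 : x ⬝ᵥ (G.adjMatrix ℝ).mulVec x = ∑ u, x u * adjSum G x u := by
    rw [← adjMatrix_mulVec_eq_adjSum]
    simp only [dotProduct]
  have h2 : x ⬝ᵥ (spectralRadius G • x) = spectralRadius G * ∑ u, x u ^ 2 := by
    rw [dotProduct_smul, smul_eq_mul]
    simp only [dotProduct, sq]
  rw [← h1, ← h2]
  convert sub_nonneg.1 h

/-- A vector attaining the Rayleigh bound is an eigenvector for the spectral radius. -/
theorem adjSum_eq_of_sum_mul_eq [Nonempty V] (G : SimpleGraph V) (x : V → ℝ)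
    (hx : ∑ u, x u * adjSum G x u = spectralRadius G * ∑ u, x u ^ 2) (u : V) :
    adjSum G x u = spectralRadius G * x u := by
  classical
  have h := ((posSemidef_spectralRadius_sub G).dotProduct_mulVec_zero_iff x).1 (by
    rw [Matrix.sub_mulVec, Matrix.smul_mulVec, Matrix.one_mulVec, dotProduct_sub, star_trivial,
      dotProduct_smul, smul_eq_mul, adjMatrix_mulVec_eq_adjSum]
    simp only [dotProduct, ← sq]
    rw [hx, sub_self])
  rw [Matrix.sub_mulVec, Matrix.smul_mulVec, Matrix.one_mulVec, adjMatrix_mulVec_eq_adjSum] at h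
  have := congrFun h u
  simp only [Pi.sub_apply, Pi.smul_apply, smul_eq_mul, Pi.zero_apply] at this
  linarith

theorem spectralRadius_le_of_forall [Nonempty V] {G : SimpleGraph V} {s : ℝ}
    (h : ∀ x : V → ℝ, ∑ u, x u * adjSum G x u ≤ s * ∑ u, x u ^ 2) : spectralRadius G ≤ s := by
  classical
  obtain ⟨x, hx, hx0⟩ := (spectralRadius_isGreatest G).1.exists_hasEigenvector
  rw [Module.End.mem_eigenspace_iff, Matrix.toLin'_apply, adjMatrix_mulVec_eq_adjSum] at hx
  have h1 := h x
  rw [hx] at h1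
  have h2 : ∑ u, x u * (spectralRadius G • x) u = spectralRadius G * ∑ u, x u ^ 2 := by
    rw [Finset.mul_sum]
    refine Finset.sum_congr rfl fun u _ => ?_
    simp only [Pi.smul_apply, smul_eq_mul]
    ring
  rw [h2] at h1
  refine le_of_mul_le_mul_right h1 ?_
  obtain ⟨u, hu⟩ := Function.ne_iff.1 hx0
  exact Finset.sum_pos' (fun v _ => sq_nonneg _) ⟨u, Finset.mem_univ _, sq_pos_of_ne_zero hu⟩

theorem spectralRadius_nonneg [hV : Nonempty V] (G : SimpleGraph V) : 0 ≤ spectralRadius G := by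
  classical
  have w := hV.some
  have h := sum_mul_adjSum_le G (Pi.single w 1)
  have h1 : ∑ u, (Pi.single w (1 : ℝ) : V → ℝ) u * adjSum G (Pi.single w 1) u = 0 := by
    rw [Finset.sum_eq_single w (fun b _ hb => by simp [hb]) (by simp), adjSum,
      Finset.sum_eq_zero, mul_zero]
    intro v _
    split_ifs with hv
    · exact Pi.single_eq_of_ne hv.ne' _
    · rfl
  have h2 : ∑ u, (Pi.single w (1 : ℝ) : V → ℝ) u ^ 2 = 1 := by
    rw [Finset.sum_eq_single w (fun b _ hb => by simp [hb]) (by simp)]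
    simp
  rw [h1, h2] at h
  linarith

/-- A bipartite graph with parts of sizes `a` and `b` has spectral radius at most `√(ab)`. -/
theorem spectralRadius_le_sqrt [Nonempty V] {G : SimpleGraph V} {S T : Finset V}
    (hST : Disjoint S T)
    (hadj : ∀ u v, G.Adj u v → (u ∈ S ∧ v ∈ T) ∨ (u ∈ T ∧ v ∈ S)) :
    spectralRadius G ≤ √(S.card * T.card) := by
  classical
  refine spectralRadius_le_of_forall fun x => ?_
  set f : Finset V → V → ℝ := fun R u => if u ∈ R then |x u| else 0 with hf
  have hf0 : ∀ R u, 0 ≤ f R u := fun R u => by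
    simp only [hf]
    split_ifs <;> positivity
  have hsum : ∀ R : Finset V, ∑ u, f R u = ∑ u ∈ R, |x u| := fun R => by
    simp [hf]
  set P := ∑ u ∈ S, |x u| with hP
  set Q := ∑ u ∈ T, |x u| with hQ
  have h1 : ∑ u, x u * adjSum G x u ≤ 2 * (P * Q) := by
    have : 2 * (P * Q) = ∑ u, ∑ v, (f S u * f T v + f T u * f S v) := by
      simp only [Finset.sum_add_distrib, ← Finset.sum_mul_sum, hsum]
      ring
    rw [this]
    refine Finset.sum_le_sum fun u _ => ?_
    rw [adjSum, Finset.mul_sum]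
    refine Finset.sum_le_sum fun v _ => ?_
    have n1 := mul_nonneg (hf0 S u) (hf0 T v)
    have n2 := mul_nonneg (hf0 T u) (hf0 S v)
    split_ifs with huv
    · have hle : x u * x v ≤ |x u| * |x v| := by
        rw [← abs_mul]
        exact le_abs_self _
      rcases hadj u v huv with ⟨hu, hv⟩ | ⟨hu, hv⟩
      · have : f S u * f T v = |x u| * |x v| := by simp [hf, hu, hv]
        linarith
      · have : f T u * f S v = |x u| * |x v| := by simp [hf, hu, hv]
        linarith
    · linarith
  set X := ∑ u ∈ S, x u ^ 2 with hX
  set Y := ∑ u ∈ T, x u ^ 2 with hY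
  have hPX : P ^ 2 ≤ S.card * X := by
    have := sq_sum_le_card_mul_sum_sq (s := S) (f := fun u => |x u|)
    simpa only [sq_abs] using this
  have hQY : Q ^ 2 ≤ T.card * Y := by
    have := sq_sum_le_card_mul_sum_sq (s := T) (f := fun u => |x u|)
    simpa only [sq_abs] using this
  have hX0 : 0 ≤ X := Finset.sum_nonneg fun u _ => sq_nonneg _
  have hY0 : 0 ≤ Y := Finset.sum_nonneg fun u _ => sq_nonneg _
  have hXY : X + Y ≤ ∑ u, x u ^ 2 := by
    rw [hX, hY, ← Finset.sum_union hST]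
    exact Finset.sum_le_sum_of_subset_of_nonneg (Finset.subset_univ _) fun _ _ _ => sq_nonneg _
  have hs : √((S.card : ℝ) * T.card) ^ 2 = S.card * T.card := Real.sq_sqrt (by positivity)
  have h2 : 2 * (P * Q) ≤ √((S.card : ℝ) * T.card) * (X + Y) := by
    refine le_of_sq_le_sq ?_ (by positivity)
    calc (2 * (P * Q)) ^ 2 = 4 * (P ^ 2 * Q ^ 2) := by ring
      _ ≤ 4 * ((S.card * X) * (T.card * Y)) := by gcongr
      _ = (S.card * T.card) * (4 * (X * Y)) := by ring
      _ ≤ (S.card * T.card) * (X + Y) ^ 2 := by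
        gcongr
        nlinarith [sq_nonneg (X - Y)]
      _ = _ := by rw [mul_pow, hs]
  refine (h1.trans h2).trans ?_
  gcongr

theorem deg_eq_adjSum_one (G : SimpleGraph V) (u : V) : (deg G u : ℝ) = adjSum G
    (fun _ => 1) u := by
  classical
  rw [deg, Set.ncard_eq_toFinset_card', adjSum, Finset.sum_boole]
  congr 2
  ext v
  simp

/-- If `s² ≤ d(u) d(v)` for all edges `uv` of `F`, then `s` is a lower bound for the spectral
radius of each graph containing `F`: use the test vector `√d`. If `s` is attained by `F'`, the
products are all equal to `s²`, and, the test vector being an eigenvector of both graphs, the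
edges of `F'` not in `F` join isolated vertices of `F`. -/
theorem le_spectralRadius_of_deg_mul_deg [Nonempty V] {F F' : SimpleGraph V} (hFF' : F ≤ F')
    {s : ℝ} (hF : ∀ u v, F.Adj u v → s ^ 2 ≤ deg F u * deg F v)
    {a b : V} (hab : F.Adj a b) :
    s ≤ spectralRadius F' ∧ (spectralRadius F' ≤ s →
      (∀ u v, F.Adj u v → (deg F u * deg F v : ℝ) = s ^ 2) ∧
      ∀ u v, F'.Adj u v → ¬ F.Adj u v → deg F u = 0 ∧ deg F v = 0) := by
  classical
  set x : V → ℝ := fun u => √(deg F u) with hx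
  have hx0 : ∀ u, 0 ≤ x u := fun u => Real.sqrt_nonneg _
  have hxsq : ∀ u, x u ^ 2 = deg F u := fun u => Real.sq_sqrt (Nat.cast_nonneg _)
  have hdeg0 : ∀ u, x u = 0 → deg F u = 0 := fun u h => by
    have := hxsq u
    rw [h, zero_pow two_ne_zero] at this
    exact_mod_cast this.symm
  have hprod : ∀ u v, F.Adj u v → s ≤ x u * x v := fun u v h => by
    refine le_of_sq_le_sq ?_ (mul_nonneg (hx0 u) (hx0 v))
    rw [mul_pow, hxsq, hxsq]
    exact hF u v h
  have hsd : ∀ u, s * deg F u = ∑ v, if F.Adj u v then s else 0 := fun u => by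
    rw [deg_eq_adjSum_one, adjSum, Finset.mul_sum]
    simp
  have hterm : ∀ u, ∀ v, (if F.Adj u v then s else 0) ≤ if F.Adj u v then x u * x v else 0 :=
    fun u v => by
      split_ifs with h
      · exact hprod u v h
      · exact le_rfl
  have hmul : ∀ u, x u * adjSum F x u = ∑ v, if F.Adj u v then x u * x v else 0 := fun u => by
    rw [adjSum, Finset.mul_sum]
    simp
  have hlow : ∀ u, s * x u ^ 2 ≤ x u * adjSum F x u := fun u => by
    rw [hxsq, hsd, hmul]
    exact Finset.sum_le_sum fun v _ => hterm u v
  have hmono : ∀ u, adjSum F x u ≤ adjSum F' x u := fun u => by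
    refine Finset.sum_le_sum fun v _ => ?_
    by_cases h : F.Adj u v
    · rw [if_pos h, if_pos (hFF' h)]
    · rw [if_neg h]
      split_ifs
      · exact hx0 v
      · exact le_rfl
  have hlow' : ∀ u, s * x u ^ 2 ≤ x u * adjSum F' x u := fun u =>
    (hlow u).trans (mul_le_mul_of_nonneg_left (hmono u) (hx0 u))
  have hD : 0 < ∑ u, x u ^ 2 := by
    refine Finset.sum_pos' (fun v _ => sq_nonneg _) ⟨a, Finset.mem_univ _, ?_⟩
    rw [hxsq, Nat.cast_pos, deg, Set.ncard_pos (Set.toFinite _)]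
    exact ⟨b, hab⟩
  have hray := sum_mul_adjSum_le F' x
  have hsum : s * ∑ u, x u ^ 2 ≤ ∑ u, x u * adjSum F' x u := by
    rw [Finset.mul_sum]
    exact Finset.sum_le_sum fun u _ => hlow' u
  have hle : s ≤ spectralRadius F' := le_of_mul_le_mul_right (hsum.trans hray) hD
  refine ⟨hle, fun hge => ?_⟩
  have hρ : spectralRadius F' = s := le_antisymm hge hle
  rw [hρ] at hray
  have hQ : ∑ u, x u * adjSum F' x u = s * ∑ u, x u ^ 2 := le_antisymm hray hsum
  have heig := adjSum_eq_of_sum_mul_eq F' x (by rw [hρ, hQ])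
  rw [hρ] at heig
  have heq : ∀ u, s * x u ^ 2 = x u * adjSum F x u := fun u => by
    refine le_antisymm (hlow u) ?_
    refine (mul_le_mul_of_nonneg_left (hmono u) (hx0 u)).trans ?_
    rw [heig u]
    exact le_of_eq (by ring)
  have hmain : ∀ u v, F.Adj u v → x u * x v = s := by
    intro u v huv
    have h := heq u
    rw [hxsq, hsd, hmul] at h
    have := (Finset.sum_eq_sum_iff_of_le fun v _ => hterm u v).1 h v (Finset.mem_univ _)
    rw [if_pos huv, if_pos huv] at this
    exact this.symm
  have hFeig : ∀ u, adjSum F x u = adjSum F' x u := by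
    intro u
    rw [heig]
    by_cases h : x u = 0
    · have hd := hdeg0 u h
      rw [h, mul_zero, adjSum]
      refine Finset.sum_eq_zero fun v _ => if_neg fun huv => ?_
      rw [deg, Set.ncard_eq_zero (Set.toFinite _)] at hd
      exact (Set.ext_iff.1 hd v).1 huv
    · refine mul_left_cancel₀ h ?_
      rw [← heq u]
      ring
  have hzero : ∀ u v, F'.Adj u v → ¬ F.Adj u v → deg F v = 0 := by
    intro u v h' h
    have := (Finset.sum_eq_sum_iff_of_le (s := Finset.univ)
      (f := fun v => if F.Adj u v then x v else 0) (g := fun v => if F'.Adj u v then x v else 0)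
      fun v _ => by
        by_cases h : F.Adj u v
        · rw [if_pos h, if_pos (hFF' h)]
        · rw [if_neg h]
          split_ifs
          · exact hx0 v
          · exact le_rfl).1 (hFeig u) v (Finset.mem_univ _)
    simp only [if_neg h, if_pos h'] at this
    exact hdeg0 v this.symm
  refine ⟨fun u v huv => ?_,
    fun u v h' h => ⟨hzero v u h'.symm fun h2 => h h2.symm, hzero u v h' h⟩⟩
  rw [← hxsq, ← hxsq, ← mul_pow, hmain u v huv]

/-! ### Non-Hamiltonian graphs attaining the bound -/

theorem deg_add_deg_compl {n : ℕ} (hV : Fintype.card V = n) (G : SimpleGraph V) (v : V) :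
    deg G v + deg Gᶜ v = n - 1 := by
  have hd : Disjoint (G.neighborSet v) (Gᶜ.neighborSet v) := by
    rw [Set.disjoint_left]
    intro w h1 h2
    exact ((G.compl_adj v w).1 h2).2 h1
  have hu : G.neighborSet v ∪ Gᶜ.neighborSet v = {v}ᶜ := by
    ext w
    simp only [Set.mem_union, mem_neighborSet, compl_adj, Set.mem_compl_iff,
      Set.mem_singleton_iff]
    have := G.irrefl (v := v)
    constructor
    · rintro (h | h)
      · exact h.ne'
      · exact fun h' => h.1 h'.symm
    · intro h
      by_cases hw : G.Adj v w
      · exact Or.inl hw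
      · exact Or.inr ⟨fun h' => h h'.symm, hw⟩
  rw [deg, deg, ← Set.ncard_union_eq hd (Set.toFinite _) (Set.toFinite _), hu, Set.ncard_compl,
    Set.ncard_singleton, Nat.card_eq_fintype_card, hV]

/-- If the end degrees of each edge of a graph on `k + M + 1` vertices are `k` and `M`, where
`1 ≤ k < M`, then the graph is a complete bipartite graph with parts of sizes `k` and `M` together
with an isolated vertex. -/
theorem exists_bipartition_of_deg {F : SimpleGraph V} {k M : ℕ} (hk : 1 ≤ k) (hkM : k < M)
    (hV : Fintype.card V = k + M + 1)
    (hF : ∀ u v, F.Adj u v → (deg F u = M ∧ deg F v = k) ∨ (deg F u = k ∧ deg F v = M))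
    {a b : V} (hab : F.Adj a b) :
    ∃ (w : V) (E D : Set V), E.ncard = k ∧ (∀ v, deg F v = 0 → v = w) ∧ w ∉ E ∧ w ∉ D ∧
      Disjoint E D ∧ (∀ v, v = w ∨ v ∈ E ∨ v ∈ D) ∧
      ∀ u v, F.Adj u v ↔ (u ∈ E ∧ v ∈ D) ∨ (u ∈ D ∧ v ∈ E) := by
  set E : Set V := {v | deg F v = M} with hE
  set D : Set V := {v | deg F v = k} with hD
  have hNE : ∀ e ∈ E, F.neighborSet e ⊆ D := by
    intro e he v hv
    rcases hF e v hv with h | h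
    · exact h.2
    · have := h.1.symm.trans he
      omega
  have hND : ∀ d ∈ D, F.neighborSet d ⊆ E := by
    intro d hd v hv
    rcases hF d v hv with h | h
    · have := h.1.symm.trans hd
      omega
    · exact h.2
  obtain ⟨e₀, d₀, he₀, hd₀⟩ : ∃ e₀ d₀, e₀ ∈ E ∧ d₀ ∈ D := by
    rcases hF a b hab with h | h
    · exact ⟨a, b, h.1, h.2⟩
    · exact ⟨b, a, h.2, h.1⟩
  have hDM : M ≤ D.ncard := by
    rw [← show deg F e₀ = M from he₀]
    exact Set.ncard_le_ncard (hNE e₀ he₀) (Set.toFinite _)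
  have hEk : k ≤ E.ncard := by
    rw [← show deg F d₀ = k from hd₀]
    exact Set.ncard_le_ncard (hND d₀ hd₀) (Set.toFinite _)
  have hdisj : Disjoint E D := by
    rw [Set.disjoint_left]
    intro v h1 h2
    have : M = k := h1.symm.trans h2
    omega
  have hun : (E ∪ D).ncard = E.ncard + D.ncard :=
    Set.ncard_union_eq hdisj (Set.toFinite _) (Set.toFinite _)
  have huniv := Set.ncard_add_ncard_compl (E ∪ D)
  rw [Nat.card_eq_fintype_card, hV, hun] at huniv
  -- if `D` has `M` elements, each `e ∈ E` is adjacent to all of `D`; likewise for `E`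
  have hcompE : D.ncard = M → ∀ e ∈ E, ∀ v, F.Adj e v ↔ v ∈ D := fun h e he =>
    adj_iff_of_neighborSet_subset (hNE e he) (by rw [h]; exact (show deg F e = M from he).ge)
  have hcompD : E.ncard = k → ∀ d ∈ D, ∀ v, F.Adj d v ↔ v ∈ E := fun h d hd =>
    adj_iff_of_neighborSet_subset (hND d hd) (by rw [h]; exact (show deg F d = k from hd).ge)
  have hle1 : D.ncard = M → E.ncard ≤ k := fun h => by
    rw [← show deg F d₀ = k from hd₀]
    exact Set.ncard_le_ncard (fun e he => ((hcompE h e he d₀).2 hd₀).symm) (Set.toFinite _)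
  have hle2 : E.ncard = k → D.ncard ≤ M := fun h => by
    rw [← show deg F e₀ = M from he₀]
    exact Set.ncard_le_ncard (fun d hd => ((hcompD h d hd e₀).2 he₀).symm) (Set.toFinite _)
  have hEc : E.ncard = k := by
    by_contra hne
    have := hle1 (by omega)
    omega
  have hDc : D.ncard = M := by
    have := hle2 hEc
    omega
  obtain ⟨w, hw⟩ := Set.ncard_eq_one.1 (show (E ∪ D)ᶜ.ncard = 1 by omega)
  have hww : w ∈ (E ∪ D)ᶜ := by rw [hw]; rfl
  simp only [Set.mem_compl_iff, Set.mem_union, not_or] at hww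
  have hmem : ∀ v, v ∉ E → v ∉ D → v = w := by
    intro v h1 h2
    have : v ∈ (E ∪ D)ᶜ := by simp [h1, h2]
    rw [hw] at this
    exact this
  refine ⟨w, E, D, hEc, ?_, hww.1, hww.2, hdisj, ?_, ?_⟩
  · intro v hv
    refine hmem v ?_ ?_
    · intro h
      have : M = 0 := h.symm.trans hv
      omega
    · intro h
      have : k = 0 := h.symm.trans hv
      omega
  · intro v
    by_cases h1 : v ∈ E
    · exact Or.inr (Or.inl h1)
    · by_cases h2 : v ∈ D
      · exact Or.inr (Or.inr h2)
      · exact Or.inl (hmem v h1 h2)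
  · intro u v
    constructor
    · intro h
      rcases hF u v h with h' | h'
      · exact Or.inl h'
      · exact Or.inr h'
    · rintro (h | h)
      · exact (hcompE hDc u h.1 v).2 h.2
      · exact (hcompD hEc u h.1 v).2 h.2

theorem mul_le_mul_of_le_add {a b k M : ℕ} (ha : a ≤ M) (hb : b ≤ M) (h : k + M ≤ a + b) :
    k * M ≤ a * b := by
  obtain ⟨c, rfl⟩ := Nat.exists_eq_add_of_le ha
  obtain ⟨d, hd⟩ := Nat.exists_eq_add_of_le hb
  have hbk : k + c ≤ b := by omega
  calc k * (a + c) = k * a + k * c := by ring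
    _ ≤ k * a + a * c := by
        have : k ≤ a := by omega
        nlinarith
    _ = a * (k + c) := by ring
    _ ≤ a * b := Nat.mul_le_mul_left a hbk

theorem eq_of_mul_eq_mul_of_le_add {a b k M : ℕ} (hk : 1 ≤ k) (ha : a ≤ M) (hb : b ≤ M)
    (h : k + M ≤ a + b) (hab : a * b = k * M) : (a = M ∧ b = k) ∨ (a = k ∧ b = M) := by
  obtain ⟨c, rfl⟩ := Nat.exists_eq_add_of_le ha
  obtain ⟨d, rfl⟩ : ∃ d, b = k + c + d := ⟨b - (k + c), by omega⟩
  obtain ⟨f, rfl⟩ : ∃ f, a = k + f := ⟨a - k, by omega⟩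
  have h1 : f * c + (k + f) * d = 0 := by nlinarith
  have h2 : f * c = 0 := by omega
  have h3 : (k + f) * d = 0 := by omega
  have h4 : d = 0 := by
    rcases Nat.mul_eq_zero.1 h3 with h | h <;> omega
  subst h4
  rcases Nat.mul_eq_zero.1 h2 with rfl | rfl
  · right
    omega
  · left
    omega

/-- The spectral bound for non-Hamiltonian graphs, and the graphs attaining it. -/
theorem sqrt_le_spectralRadius_compl [DecidableEq V] {G : SimpleGraph V} {n k : ℕ}
    (hV : Fintype.card V = n) (hk : 1 ≤ k) (hkn : 2 * k + 1 ≤ n) (hG : ¬ G.IsHamiltonian)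
    (hd : ∀ v, k ≤ deg G v) :
    √(k * (n - k - 1 : ℕ)) ≤ spectralRadius Gᶜ ∧
    (spectralRadius Gᶜ ≤ √(k * (n - k - 1 : ℕ)) →
      HasLShape G k ∨ (n = 2 * k + 1 ∧ HasHShape G)) := by
  have hn : 3 ≤ n := by omega
  obtain ⟨M, rfl⟩ : ∃ M, n = k + M + 1 := ⟨n - k - 1, by omega⟩
  rw [show k + M + 1 - k - 1 = M by omega]
  have : Nonempty V := Fintype.card_pos_iff.1 (by omega)
  obtain ⟨H, hGH, hH⟩ := Finite.exists_le_maximal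
    (p := fun G : SimpleGraph V => ¬ G.IsHamiltonian) hG
  have hle : ∀ v, deg Hᶜ v ≤ M := fun v => by
    have h1 := deg_add_deg_compl hV H v
    have h2 := (hd v).trans (deg_mono hGH v)
    omega
  have hadd : ∀ u v, Hᶜ.Adj u v → k + M ≤ deg Hᶜ u + deg Hᶜ v := fun u v h => by
    have h1 := deg_add_deg_compl hV H u
    have h2 := deg_add_deg_compl hV H v
    have h3 := deg_add_deg_le_of_maximal hn hV hH h.ne ((H.compl_adj u v).1 h).2
    omega
  obtain ⟨a, b, hab, hadj⟩ := exists_not_adj_of_not_isHamiltonian hn hV hH.1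
  have hsq : √((k : ℝ) * M) ^ 2 = k * M := Real.sq_sqrt (by positivity)
  obtain ⟨hlow, heq⟩ := le_spectralRadius_of_deg_mul_deg (F := Hᶜ) (F' := Gᶜ)
    (compl_le_compl hGH) (s := √((k : ℝ) * M)) (fun u v h => by
      rw [hsq]
      exact_mod_cast mul_le_mul_of_le_add (hle u) (hle v) (hadd u v h))
    ((H.compl_adj a b).2 ⟨hab, hadj⟩)
  refine ⟨hlow, fun hup => ?_⟩
  rcases (show k = M ∨ k < M by omega) with rfl | hkM
  · have hV' : Fintype.card V = 2 * k + 1 := by omega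
    exact (hasLShape_or_hasHShape hk hV' hG hd).imp_right fun h => ⟨by omega, h⟩
  left
  obtain ⟨hprod, hextra⟩ := heq hup
  obtain ⟨w, E, D, hE, hw0, hwE, hwD, hdisj, hcov, hF⟩ := exists_bipartition_of_deg (F := Hᶜ) hk hkM
    hV (fun u v h => by
      refine eq_of_mul_eq_mul_of_le_add hk (hle u) (hle v) (hadd u v h) ?_
      have := hprod u v h
      rw [hsq] at this
      exact_mod_cast this) ((H.compl_adj a b).2 ⟨hab, hadj⟩)
  have hGH' : ∀ u v, G.Adj u v ↔ u ≠ v ∧ ¬ Hᶜ.Adj u v := by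
    intro u v
    constructor
    · exact fun h => ⟨h.ne, fun h' => ((H.compl_adj u v).1 h').2 (hGH h)⟩
    · rintro ⟨hne, h⟩
      by_contra hc
      obtain ⟨h1, h2⟩ := hextra u v ((G.compl_adj u v).2 ⟨hne, hc⟩) h
      exact hne ((hw0 u h1).trans (hw0 v h2).symm)
  refine ⟨w, E, hwE, hE, fun u v => ?_⟩
  rw [hGH', hF]
  have hED : ∀ x, x ∈ E → x ∉ D := fun x h h' => Set.disjoint_left.1 hdisj h h'
  have hcu := hcov u
  have hcv := hcov v
  clear * - hED hwE hwD hcu hcv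
  grind

theorem HasHShape.not_isHamiltonian [DecidableEq V] {G : SimpleGraph V} {n : ℕ} (hn : 3 ≤ n)
    (hV : Fintype.card V = n) (h : HasHShape G) : ¬ G.IsHamiltonian := by
  intro hham
  obtain ⟨q, hq, hadj⟩ := IsHamiltonian.exists_zmod hn hV hham
  obtain ⟨S, hS, hSadj⟩ := h
  rw [Nat.card_eq_fintype_card, hV] at hS
  have : NeZero n := ⟨by omega⟩
  have hbij : Function.Bijective q :=
    (Fintype.bijective_iff_injective_and_card q).2 ⟨hq, by rw [ZMod.card, hV]⟩
  have hsub : (fun i => q (i + 1)) '' (q ⁻¹' S) ⊆ Sᶜ := by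
    rintro _ ⟨i, hi, rfl⟩
    exact (hSadj _ hi _).1 (hadj i)
  have h1 := Set.ncard_le_ncard hsub (Set.toFinite _)
  rw [Set.ncard_image_of_injective _ fun i j h => add_right_cancel (hq h),
    Set.ncard_preimage_of_injective_subset_range hq
      (by rw [hbij.2.range_eq]; exact Set.subset_univ _),
    Set.ncard_compl, hS, Nat.card_eq_fintype_card, hV] at h1
  omega

theorem HasLShape.not_isHamiltonian [DecidableEq V] {G : SimpleGraph V} {n k : ℕ} (hk : 1 ≤ k)
    (hn : k + 2 ≤ n) (hV : Fintype.card V = n) (h : HasLShape G k) : ¬ G.IsHamiltonian := by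
  intro hham
  obtain ⟨q, hq, hadj⟩ := IsHamiltonian.exists_zmod (by omega) hV hham
  obtain ⟨w, S, hw, hS, hSadj⟩ := h
  have : NeZero n := ⟨by omega⟩
  have hbij : Function.Bijective q :=
    (Fintype.bijective_iff_injective_and_card q).2 ⟨hq, by rw [ZMod.card, hV]⟩
  obtain ⟨i, hi⟩ := hbij.2 w
  have hne : ∀ m : ℕ, m + 1 < n → q (i + 1 + (m : ZMod n)) ≠ w := by
    intro m hm h
    rw [← hi] at h
    have h1 : ((m + 1 : ℕ) : ZMod n) = 0 := by
      push_cast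
      linear_combination hq h
    have := Nat.eq_zero_of_dvd_of_lt ((ZMod.natCast_eq_zero_iff _ n).1 h1) hm
    omega
  -- between two visits to `w` the cycle stays on one side of the separation
  have hside : ∀ m : ℕ, m + 1 < n → (q (i + 1 + (m : ZMod n)) ∈ S ↔ q (i + 1) ∈ S) := by
    intro m
    induction m with
    | zero => simp
    | succ m ih =>
      intro hm
      have h1 := hne m (by omega)
      have h2 := hne (m + 1) hm
      rw [← ih (by omega)]
      push_cast at h2 ⊢
      rw [← add_assoc] at h2 ⊢
      have := ((hSadj _ _).1 (hadj (i + 1 + (m : ZMod n)))).2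
      tauto
  have hall : ∀ v, v ≠ w → (v ∈ S ↔ q (i + 1) ∈ S) := by
    intro v hv
    obtain ⟨j, rfl⟩ := hbij.2 v
    have h1 := hside (j - (i + 1)).val
    rw [ZMod.natCast_zmod_val, add_sub_cancel] at h1
    refine h1 ?_
    have h2 := ZMod.val_lt (j - (i + 1))
    by_contra hc
    refine hv ?_
    rw [← hi]
    have h3 := zmod_add_one_eq_zero (show (j - (i + 1)).val + 1 = n by omega)
    congr 1
    linear_combination h3
  obtain ⟨s, hs⟩ : S.Nonempty := by
    rw [← Set.ncard_pos (Set.toFinite _)]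
    omega
  obtain ⟨t, ht⟩ : (insert w S)ᶜ.Nonempty := by
    rw [← Set.ncard_pos (Set.toFinite _), Set.ncard_compl,
      Set.ncard_insert_of_notMem hw (Set.toFinite _), Nat.card_eq_fintype_card, hV]
    omega
  simp only [Set.mem_compl_iff, Set.mem_insert_iff, not_or] at ht
  have h1 := hall s (fun h => hw (h ▸ hs))
  have h2 := hall t ht.1
  tauto

theorem HasLShape.le_deg {G : SimpleGraph V} {n k : ℕ} (hn : 2 * k + 1 ≤ n)
    (hV : Fintype.card V = n) (h : HasLShape G k) (v : V) : k ≤ deg G v := by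
  obtain ⟨w, S, hw, hS, hadj⟩ := h
  have hins := Set.ncard_insert_of_notMem hw (Set.toFinite _)
  by_cases hvS : v ∈ S
  · have hsub : insert w S \ {v} ⊆ G.neighborSet v := by
      intro u hu
      simp only [Set.mem_sdiff, Set.mem_insert_iff, Set.mem_singleton_iff] at hu
      refine (hadj v u).2 ⟨fun h => hu.2 h.symm, ?_⟩
      tauto
    have := Set.ncard_le_ncard hsub (Set.toFinite _)
    rw [Set.ncard_sdiff_singleton_of_mem (Set.mem_insert_of_mem _ hvS)] at this
    unfold deg
    omega
  · have hsub : Sᶜ \ {v} ⊆ G.neighborSet v := by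
      intro u hu
      simp only [Set.mem_sdiff, Set.mem_compl_iff, Set.mem_singleton_iff] at hu
      refine (hadj v u).2 ⟨fun h => hu.2 h.symm, ?_⟩
      tauto
    have := Set.ncard_le_ncard hsub (Set.toFinite _)
    rw [Set.ncard_sdiff_singleton_of_mem hvS, Set.ncard_compl, Nat.card_eq_fintype_card, hV]
      at this
    unfold deg
    omega

theorem HasLShape.spectralRadius_compl_le [Nonempty V] {G : SimpleGraph V} {n k : ℕ}
    (hV : Fintype.card V = n) (h : HasLShape G k) :
    spectralRadius Gᶜ ≤ √(k * (n - k - 1 : ℕ)) := by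
  classical
  obtain ⟨w, S, hw, hS, hadj⟩ := h
  have hT : (insert w S)ᶜ.ncard = n - k - 1 := by
    rw [Set.ncard_compl, Set.ncard_insert_of_notMem hw (Set.toFinite _), hS,
      Nat.card_eq_fintype_card, hV]
    omega
  have := spectralRadius_le_sqrt (G := Gᶜ) (S := S.toFinset) (T := ((insert w S)ᶜ).toFinset) ?_ ?_
  · rwa [← Set.ncard_eq_toFinset_card', ← Set.ncard_eq_toFinset_card', hS, hT] at this
  · rw [Set.disjoint_toFinset, Set.disjoint_left]
    intro x hx hx'
    exact hx' (Set.mem_insert_of_mem _ hx)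
  · intro u v huv
    rw [compl_adj, hadj] at huv
    simp only [Set.mem_toFinset, Set.mem_compl_iff, Set.mem_insert_iff]
    tauto

/-! ### Cones and traceability -/

/-- The cone `K_1 ∨ G` over `G`, with apex `none`. -/
def cone {V : Type*} (G : SimpleGraph V) : SimpleGraph (Option V) where
  Adj a b := a ≠ b ∧ ∀ u ∈ a, ∀ v ∈ b, G.Adj u v
  symm := ⟨fun _ _ h => ⟨h.1.symm, fun u hu v hv => (h.2 v hv u hu).symm⟩⟩
  loopless := ⟨fun _ h => h.1 rfl⟩

theorem cone_adj_some {V : Type*} {G : SimpleGraph V} {u v : V} :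
    (cone G).Adj (some u) (some v) ↔ G.Adj u v := by
  simp only [cone, ne_eq, Option.some.injEq, Option.mem_def, forall_eq']
  exact ⟨fun h => h.2, fun h => ⟨h.ne, h⟩⟩

theorem cone_adj_none {V : Type*} {G : SimpleGraph V} {a : Option V} :
    (cone G).Adj none a ↔ a ≠ none := by
  simp [cone, eq_comm]

theorem isHamiltonian_cone_iff [DecidableEq V] {G : SimpleGraph V} {n : ℕ} (hn : 2 ≤ n)
    (hV : Fintype.card V = n) : (cone G).IsHamiltonian ↔ IsTraceable G := by
  have hV' : Fintype.card (Option V) = n + 1 := by rw [Fintype.card_option, hV]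
  constructor
  · intro h
    obtain ⟨q, hq, hadj⟩ := IsHamiltonian.exists_zmod (by omega) hV' h
    have hbij : Function.Bijective q :=
      (Fintype.bijective_iff_injective_and_card q).2 ⟨hq, by rw [ZMod.card, hV']⟩
    obtain ⟨i, hi⟩ := hbij.2 none
    have hne : ∀ m : ℕ, m < n → ∃ v, q (i + 1 + (m : ZMod (n + 1))) = some v := by
      intro m hm
      refine Option.ne_none_iff_exists'.1 fun h => ?_
      rw [← hi] at h
      have h1 : ((m + 1 : ℕ) : ZMod (n + 1)) = 0 := by
        push_cast
        linear_combination hq h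
      have := Nat.le_of_dvd (by omega) ((ZMod.natCast_eq_zero_iff _ _).1 h1)
      omega
    have : Nonempty V := Fintype.card_pos_iff.1 (by omega)
    have hp : ∀ m : ℕ, ∃ v, m < n → q (i + 1 + (m : ZMod (n + 1))) = some v := by
      intro m
      by_cases hm : m < n
      · obtain ⟨v, hv⟩ := hne m hm
        exact ⟨v, fun _ => hv⟩
      · exact ⟨Classical.arbitrary V, fun h => absurd h hm⟩
    choose p hp using hp
    refine isTraceable_of_seq (by omega) hV p ?_ ?_
    · intro a ha b hb hab
      have h1 := (hp a ha).trans ((congrArg some hab).trans (hp b hb).symm)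
      have := (ZMod.natCast_eq_natCast_iff' a b _).1 (add_left_cancel (hq h1))
      rwa [Nat.mod_eq_of_lt (by omega), Nat.mod_eq_of_lt (by omega)] at this
    · intro m hm
      rw [← cone_adj_some, ← hp m (by omega), ← hp (m + 1) hm]
      push_cast
      rw [← add_assoc]
      exact hadj _
  · intro h
    obtain ⟨p, hinj, hadj⟩ := IsTraceable.exists_seq hV h
    refine isHamiltonian_of_seq (n := n + 1) (by omega) hV'
      (fun m => if m < n then some (p m) else none) ?_ ?_ ?_
    · intro a ha b hb hab
      split_ifs at hab with h1 h2 h2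
      · exact hinj a h1 b h2 (Option.some_injective _ hab)
      · omega
    · intro m hm
      rw [if_pos (show m < n by omega)]
      split_ifs with h1
      · exact cone_adj_some.2 (hadj m h1)
      · exact (cone_adj_none.2 (by simp)).symm
    · simp only [show ¬ n + 1 - 1 < n by omega, if_false, if_pos (show 0 < n by omega)]
      exact cone_adj_none.2 (by simp)

theorem succ_le_deg_cone {G : SimpleGraph V} {n k : ℕ} (hV : Fintype.card V = n) (hkn : k + 1 ≤ n)
    (hd : ∀ v, k ≤ deg G v) (a : Option V) : k + 1 ≤ deg (cone G) a := by
  rcases a with _ | v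
  · have : (cone G).neighborSet none = {none}ᶜ := by
      ext a
      exact cone_adj_none
    rw [deg, this, Set.ncard_compl, Set.ncard_singleton, Nat.card_eq_fintype_card,
      Fintype.card_option, hV]
    omega
  · have : insert none (some '' G.neighborSet v) ⊆ (cone G).neighborSet (some v) := by
      rintro a (rfl | ⟨u, hu, rfl⟩)
      · exact (cone_adj_none.2 (by simp)).symm
      · exact cone_adj_some.2 hu
    have h1 := Set.ncard_le_ncard this (Set.toFinite _)
    rw [Set.ncard_insert_of_notMem (by simp) (Set.toFinite _),
      Set.ncard_image_of_injective _ (Option.some_injective _)] at h1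
    exact (Nat.add_le_add_right (hd v) 1).trans h1

/-- The complement of the cone over `G` is the complement of `G` with an isolated vertex added. -/
theorem spectralRadius_compl_cone_le [Nonempty V] (G : SimpleGraph V) :
    spectralRadius (cone G)ᶜ ≤ spectralRadius Gᶜ := by
  refine spectralRadius_le_of_forall fun x => ?_
  have h := sum_mul_adjSum_le Gᶜ fun v => x (some v)
  have h0 : adjSum (cone G)ᶜ x none = 0 := by
    rw [adjSum]
    refine Finset.sum_eq_zero fun a _ => if_neg fun ha => ?_
    rw [compl_adj, cone_adj_none] at ha
    exact ha.2 ha.1.symm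
  have h1 : ∀ v, adjSum (cone G)ᶜ x (some v) = adjSum Gᶜ (fun v => x (some v)) v := by
    intro v
    rw [adjSum, Fintype.sum_option, adjSum, if_neg, zero_add]
    · refine Finset.sum_congr rfl fun u _ => ?_
      have hiff : (cone G)ᶜ.Adj (some v) (some u) ↔ Gᶜ.Adj v u := by
        rw [compl_adj, compl_adj, cone_adj_some, ne_eq, ne_eq, Option.some_inj]
      by_cases hvu : Gᶜ.Adj v u
      · rw [if_pos hvu, if_pos (hiff.2 hvu)]
      · rw [if_neg hvu, if_neg (mt hiff.1 hvu)]
    · rw [compl_adj, adj_comm, cone_adj_none]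
      simp
  rw [Fintype.sum_option, Fintype.sum_option, h0, mul_zero, zero_add, mul_add]
  simp only [h1]
  have := mul_nonneg (spectralRadius_nonneg Gᶜ) (sq_nonneg (x none))
  linarith

/-- The structure of `K_{k+1} + K_{n-k-1}`, read off inside the vertex set: two cliques without
edges between them, one of which, `S`, has `k + 1` vertices. -/
def HasLbarShape {V : Type*} (G : SimpleGraph V) (k : ℕ) : Prop :=
  ∃ S : Set V, S.ncard = k + 1 ∧ ∀ u v, G.Adj u v ↔ u ≠ v ∧ (u ∈ S ↔ v ∈ S)

theorem hasLShape_cone_iff {G : SimpleGraph V} {n k : ℕ} (hV : Fintype.card V = n)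
    (hkn : k + 2 ≤ n) : HasLShape (cone G) (k + 1) ↔ HasLbarShape G k := by
  constructor
  · rintro ⟨w, S, hw, hS, hadj⟩
    have hnone : ∀ a, a ≠ none → none = w ∨ a = w ∨ (none ∈ S ↔ a ∈ S) := fun a ha =>
      ((hadj none a).1 (cone_adj_none.2 ha)).2
    -- the apex is adjacent to all vertices, whereas each vertex but `w` misses one of the cliques
    have hwn : w = none := by
      by_contra hwn
      by_cases hnS : none ∈ S
      · have hsub : {w}ᶜ ⊆ S := by
          intro a ha
          rcases eq_or_ne a none with rfl | han
          · exact hnS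
          · have := hnone a han
            have ha' : a ≠ w := ha
            have : ¬ none = w := fun h => hwn h.symm
            tauto
        have := Set.ncard_le_ncard hsub (Set.toFinite _)
        rw [Set.ncard_compl, Set.ncard_singleton, Nat.card_eq_fintype_card, Fintype.card_option,
          hV] at this
        omega
      · obtain ⟨a, ha⟩ : S.Nonempty := by
          rw [← Set.ncard_pos (Set.toFinite _)]
          omega
        have han : a ≠ none := fun h => hnS (h ▸ ha)
        have := hnone a han
        have h1 : ¬ none = w := fun h => hwn h.symm
        have h2 : a ≠ w := fun h => hw (h ▸ ha)
        tauto
    subst hwn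
    refine ⟨some ⁻¹' S, ?_, fun u v => ?_⟩
    · rw [← hS, Set.ncard_preimage_of_injective_subset_range (Option.some_injective _)]
      intro a ha
      exact Option.ne_none_iff_exists.1 fun h => hw (h ▸ ha)
    · rw [← cone_adj_some, hadj]
      simp
  · rintro ⟨S, hS, hadj⟩
    refine ⟨none, some '' S, by simp, ?_, ?_⟩
    · rw [Set.ncard_image_of_injective _ (Option.some_injective _), hS]
    · rintro (_ | u) (_ | v)
      · simp
      · simp [cone_adj_none]
      · rw [adj_comm]
        simp [cone_adj_none]
      · rw [cone_adj_some, hadj]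
        simp

theorem hasHShape_cone_iff {G : SimpleGraph V} {k : ℕ} (hV : Fintype.card V = 2 * k + 2) :
    HasHShape (cone G) ↔ HasHShape G := by
  have hV' : Fintype.card (Option V) = 2 * k + 3 := by rw [Fintype.card_option, hV]
  simp only [HasHShape, Nat.card_eq_fintype_card, hV, hV']
  constructor
  · rintro ⟨S, hS, hadj⟩
    have hn : none ∉ S := by
      intro hn
      have hsub : S ⊆ {none} := by
        intro a ha
        by_contra han
        exact (hadj none hn a).1 (cone_adj_none.2 han) ha
      have := Set.ncard_le_ncard hsub (Set.toFinite _)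
      rw [Set.ncard_singleton] at this
      omega
    refine ⟨some ⁻¹' S, ?_, fun u hu v => ?_⟩
    · rw [Set.ncard_preimage_of_injective_subset_range (Option.some_injective _), hS]
      · omega
      · intro a ha
        exact Option.ne_none_iff_exists.1 fun h => hn (h ▸ ha)
    · rw [← cone_adj_some, hadj _ hu]
      rfl
  · rintro ⟨S, hS, hadj⟩
    refine ⟨some '' S, ?_, ?_⟩
    · rw [Set.ncard_image_of_injective _ (Option.some_injective _), hS]
      omega
    · rintro _ ⟨u, hu, rfl⟩ (_ | v)
      · rw [adj_comm, cone_adj_none]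
        simp
      · rw [cone_adj_some, hadj u hu]
        simp

theorem HasLbarShape.le_deg {G : SimpleGraph V} {n k : ℕ} (hn : 2 * k + 2 ≤ n)
    (hV : Fintype.card V = n) (h : HasLbarShape G k) (v : V) : k ≤ deg G v := by
  obtain ⟨S, hS, hadj⟩ := h
  by_cases hvS : v ∈ S
  · have hsub : S \ {v} ⊆ G.neighborSet v := by
      intro u hu
      simp only [Set.mem_sdiff, Set.mem_singleton_iff] at hu
      refine (hadj v u).2 ⟨fun h => hu.2 h.symm, ?_⟩
      tauto
    have := Set.ncard_le_ncard hsub (Set.toFinite _)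
    rw [Set.ncard_sdiff_singleton_of_mem hvS] at this
    unfold deg
    omega
  · have hsub : Sᶜ \ {v} ⊆ G.neighborSet v := by
      intro u hu
      simp only [Set.mem_sdiff, Set.mem_compl_iff, Set.mem_singleton_iff] at hu
      refine (hadj v u).2 ⟨fun h => hu.2 h.symm, ?_⟩
      tauto
    have := Set.ncard_le_ncard hsub (Set.toFinite _)
    rw [Set.ncard_sdiff_singleton_of_mem hvS, Set.ncard_compl, Nat.card_eq_fintype_card, hV]
      at this
    unfold deg
    omega

theorem HasLbarShape.spectralRadius_compl_le [Nonempty V] {G : SimpleGraph V} {n k : ℕ}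
    (hV : Fintype.card V = n) (h : HasLbarShape G k) :
    spectralRadius Gᶜ ≤ √((k + 1 : ℕ) * (n - k - 1 : ℕ)) := by
  classical
  obtain ⟨S, hS, hadj⟩ := h
  have hT : Sᶜ.ncard = n - k - 1 := by
    rw [Set.ncard_compl, hS, Nat.card_eq_fintype_card, hV]
    omega
  have := spectralRadius_le_sqrt (G := Gᶜ) (S := S.toFinset) (T := Sᶜ.toFinset) ?_ ?_
  · rwa [← Set.ncard_eq_toFinset_card', ← Set.ncard_eq_toFinset_card', hS, hT] at this
  · rw [Set.disjoint_toFinset]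
    exact disjoint_compl_right
  · intro u v huv
    rw [compl_adj, hadj] at huv
    simp only [Set.mem_toFinset, Set.mem_compl_iff]
    tauto

/-- The spectral bound for non-traceable graphs, and the graphs attaining it: the Hamiltonian
case applied to the cone. -/
theorem sqrt_le_spectralRadius_compl_of_not_isTraceable [DecidableEq V] {G : SimpleGraph V}
    {n k : ℕ} (hV : Fintype.card V = n) (hkn : 2 * k + 2 ≤ n) (hG : ¬ IsTraceable G)
    (hd : ∀ v, k ≤ deg G v) :
    √((k + 1 : ℕ) * (n - k - 1 : ℕ)) ≤ spectralRadius Gᶜ ∧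
    (spectralRadius Gᶜ ≤ √((k + 1 : ℕ) * (n - k - 1 : ℕ)) →
      HasLbarShape G k ∨ (n = 2 * k + 2 ∧ HasHShape G)) := by
  have : Nonempty V := Fintype.card_pos_iff.1 (by omega)
  have hV' : Fintype.card (Option V) = n + 1 := by rw [Fintype.card_option, hV]
  have h := sqrt_le_spectralRadius_compl (G := cone G) (k := k + 1) hV' (by omega) (by omega)
    (by rwa [isHamiltonian_cone_iff (by omega) hV]) (succ_le_deg_cone hV (by omega) hd)
  rw [show n + 1 - (k + 1) - 1 = n - k - 1 by omega] at h
  have hle := spectralRadius_compl_cone_le G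
  refine ⟨h.1.trans hle, fun hup => ?_⟩
  rcases h.2 (hle.trans hup) with h1 | ⟨h1, h2⟩
  · exact Or.inl ((hasLShape_cone_iff hV (by omega)).1 h1)
  · have hn : n = 2 * k + 2 := by omega
    exact Or.inr ⟨hn, (hasHShape_cone_iff (hV.trans hn)).1 h2⟩

theorem HasLbarShape.not_isTraceable [DecidableEq V] {G : SimpleGraph V} {n k : ℕ}
    (hn : k + 2 ≤ n) (hV : Fintype.card V = n) (h : HasLbarShape G k) : ¬ IsTraceable G := by
  rw [← isHamiltonian_cone_iff (by omega) hV]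
  exact ((hasLShape_cone_iff hV hn).2 h).not_isHamiltonian (n := n + 1) (by omega) (by omega)
    (by rw [Fintype.card_option, hV])

theorem HasHShape.not_isTraceable [DecidableEq V] {G : SimpleGraph V} {k : ℕ}
    (hV : Fintype.card V = 2 * k + 2) (h : HasHShape G) : ¬ IsTraceable G := by
  rw [← isHamiltonian_cone_iff (by omega) hV]
  exact ((hasHShape_cone_iff hV).2 h).not_isHamiltonian (n := 2 * k + 3) (by omega)
    (by rw [Fintype.card_option, hV])

/-! ### The extremal graphs up to isomorphism -/

theorem nonempty_iso_L_iff {G : SimpleGraph V} {n k : ℕ} (hV : Fintype.card V = n)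
    (hkn : k + 1 ≤ n) : Nonempty (G ≃g L n k) ↔ HasLShape G k := by
  classical
  constructor
  · rintro ⟨e⟩
    obtain ⟨f, hf, hsurj, hadj⟩ : ∃ f : _ → V, Function.Injective f ∧ Function.Surjective f ∧
        ∀ a b, G.Adj (f a) (f b) ↔ (L n k).Adj a b :=
      ⟨e.symm, e.symm.injective, e.symm.surjective, fun _ _ => e.symm.map_adj_iff⟩
    refine ⟨f (Sum.inl 0), (fun i => f (Sum.inr (Sum.inl i))) '' Set.univ, ?_, ?_, ?_⟩
    · simp [hf.eq_iff]
    · rw [Set.ncard_image_of_injective _ fun i j h => by simpa using hf h, Set.ncard_univ,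
        Nat.card_eq_fintype_card, Fintype.card_fin]
    · intro u v
      obtain ⟨a, rfl⟩ := hsurj u
      obtain ⟨b, rfl⟩ := hsurj v
      rw [hadj]
      rcases a with a | a | a <;> rcases b with b | b | b <;>
        simp [hf.eq_iff, L, join, Subsingleton.elim _ (0 : Fin 1)]
  · rintro ⟨w, S, hw, hS, hadj⟩
    have hT : (insert w S)ᶜ.ncard = n - k - 1 := by
      rw [Set.ncard_compl, Set.ncard_insert_of_notMem hw (Set.toFinite _), hS,
        Nat.card_eq_fintype_card, hV]
      omega
    have eS : Fin k ≃ S := Fintype.equivOfCardEq (by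
      rw [Fintype.card_fin, ← hS, Set.ncard_eq_toFinset_card', Set.toFinset_card])
    have eT : Fin (n - k - 1) ≃ ((insert w S)ᶜ : Set V) := Fintype.equivOfCardEq (by
      rw [Fintype.card_fin, ← hT, Set.ncard_eq_toFinset_card', Set.toFinset_card])
    have hT' : ∀ i, (eT i : V) ≠ w ∧ (eT i : V) ∉ S := fun i => by
      have := (eT i).2
      simpa only [Set.mem_compl_iff, Set.mem_insert_iff, not_or] using this
    have hS' : ∀ i, (eS i : V) ≠ w := fun i h => hw (h ▸ (eS i).2)
    let f : Fin 1 ⊕ (Fin k ⊕ Fin (n - k - 1)) → V :=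
      Sum.elim (fun _ => w) (Sum.elim (fun i => eS i) (fun i => eT i))
    have hf : Function.Injective f := by
      rintro (a | a | a) (b | b | b) h <;> simp only [f, Sum.elim_inl, Sum.elim_inr] at h
      · rw [Subsingleton.elim a b]
      · exact absurd h.symm (hS' b)
      · exact absurd h.symm (hT' b).1
      · exact absurd h (hS' a)
      · rw [eS.injective (Subtype.ext h)]
      · exact absurd (h ▸ (eS a).2) (hT' b).2
      · exact absurd h (hT' a).1
      · exact absurd (h ▸ (eS b).2) (hT' a).2
      · rw [eT.injective (Subtype.ext h)]
    have hbij : Function.Bijective f := (Fintype.bijective_iff_injective_and_card f).2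
      ⟨hf, by simp only [Fintype.card_sum, Fintype.card_fin, hV]; omega⟩
    refine ⟨(RelIso.symm ⟨Equiv.ofBijective f hbij, fun {a b} => ?_⟩ : G ≃g L n k)⟩
    rw [Equiv.ofBijective_apply, Equiv.ofBijective_apply, hadj, hf.ne_iff]
    rcases a with a | a | a <;> rcases b with b | b | b <;>
      simp [f, L, join, hS', hT', Subsingleton.elim _ (0 : Fin 1)]

theorem nonempty_iso_Lbar_iff {G : SimpleGraph V} {n k : ℕ} (hV : Fintype.card V = n)
    (hkn : k + 1 ≤ n) : Nonempty (G ≃g Lbar n k) ↔ HasLbarShape G k := by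
  classical
  constructor
  · rintro ⟨e⟩
    obtain ⟨f, hf, hsurj, hadj⟩ : ∃ f : _ → V, Function.Injective f ∧ Function.Surjective f ∧
        ∀ a b, G.Adj (f a) (f b) ↔ (Lbar n k).Adj a b :=
      ⟨e.symm, e.symm.injective, e.symm.surjective, fun _ _ => e.symm.map_adj_iff⟩
    refine ⟨(fun i => f (Sum.inl i)) '' Set.univ, ?_, ?_⟩
    · rw [Set.ncard_image_of_injective _ fun i j h => by simpa using hf h, Set.ncard_univ,
        Nat.card_eq_fintype_card, Fintype.card_fin]
    · intro u v
      obtain ⟨a, rfl⟩ := hsurj u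
      obtain ⟨b, rfl⟩ := hsurj v
      rw [hadj]
      rcases a with a | a <;> rcases b with b | b <;> simp [hf.eq_iff, Lbar]
  · rintro ⟨S, hS, hadj⟩
    have hT : Sᶜ.ncard = n - k - 1 := by
      rw [Set.ncard_compl, hS, Nat.card_eq_fintype_card, hV]
      omega
    have eS : Fin (k + 1) ≃ S := Fintype.equivOfCardEq (by
      rw [Fintype.card_fin, ← hS, Set.ncard_eq_toFinset_card', Set.toFinset_card])
    have eT : Fin (n - k - 1) ≃ (Sᶜ : Set V) := Fintype.equivOfCardEq (by
      rw [Fintype.card_fin, ← hT, Set.ncard_eq_toFinset_card', Set.toFinset_card])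
    have hT' : ∀ i, (eT i : V) ∉ S := fun i => (eT i).2
    let f : Fin (k + 1) ⊕ Fin (n - k - 1) → V := Sum.elim (fun i => eS i) (fun i => eT i)
    have hf : Function.Injective f := by
      rintro (a | a) (b | b) h <;> simp only [f, Sum.elim_inl, Sum.elim_inr] at h
      · rw [eS.injective (Subtype.ext h)]
      · exact absurd (h ▸ (eS a).2) (hT' b)
      · exact absurd (h ▸ (eS b).2) (hT' a)
      · rw [eT.injective (Subtype.ext h)]
    have hbij : Function.Bijective f := (Fintype.bijective_iff_injective_and_card f).2
      ⟨hf, by simp only [Fintype.card_sum, Fintype.card_fin, hV]; omega⟩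
    refine ⟨(RelIso.symm ⟨Equiv.ofBijective f hbij, fun {a b} => ?_⟩ : G ≃g Lbar n k)⟩
    rw [Equiv.ofBijective_apply, Equiv.ofBijective_apply, hadj, hf.ne_iff]
    rcases a with a | a <;> rcases b with b | b <;> simp [f, Lbar, hT']

theorem inH_iff {G : SimpleGraph V} (hV : 1 ≤ Fintype.card V) : InH G ↔ HasHShape G := by
  classical
  constructor
  · rintro ⟨a, b, e, ha, hb, hlow, hup⟩
    refine ⟨Set.range fun i => e (Sum.inr i), ?_, ?_⟩
    · rw [← Set.image_univ, Set.ncard_image_of_injective _ fun i j h => by simpa using h,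
        Set.ncard_univ, Nat.card_eq_fintype_card, Fintype.card_fin, hb, Nat.card_eq_fintype_card]
    · rintro _ ⟨i, rfl⟩ v
      obtain ⟨c, rfl⟩ := e.surjective v
      rcases c with c | c
      · have : (G.comap e).Adj (Sum.inr i) (Sum.inl c) := hlow (by simp)
        simpa using this
      · refine ⟨fun h => ?_, fun h => absurd ⟨c, rfl⟩ h⟩
        have := hup (show (G.comap e).Adj (Sum.inr i) (Sum.inr c) from h)
        simp [join] at this
  · rintro ⟨S, hS, hadj⟩
    rw [Nat.card_eq_fintype_card] at hS
    have hT : Sᶜ.ncard = (Fintype.card V + 1) / 2 - 1 := by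
      rw [Set.ncard_compl, hS, Nat.card_eq_fintype_card]
      omega
    have eS : Fin (Fintype.card V / 2 + 1) ≃ S := Fintype.equivOfCardEq (by
      rw [Fintype.card_fin, ← hS, Set.ncard_eq_toFinset_card', Set.toFinset_card])
    have eT : Fin ((Fintype.card V + 1) / 2 - 1) ≃ (Sᶜ : Set V) := Fintype.equivOfCardEq (by
      rw [Fintype.card_fin, ← hT, Set.ncard_eq_toFinset_card', Set.toFinset_card])
    have hT' : ∀ i, (eT i : V) ∉ S := fun i => (eT i).2
    have hS' : ∀ i, (eS i : V) ∈ S := fun i => (eS i).2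
    refine ⟨_, _, (Equiv.sumCongr eT eS).trans ((Equiv.sumComm _ _).trans (Equiv.Set.sumCompl S)),
      by omega, rfl, ?_, ?_⟩
    · rintro (a | a) (b | b) h
      · simp at h
      · refine SimpleGraph.Adj.symm ?_
        simpa using (hadj _ (hS' b) _).2 (hT' a)
      · simpa using (hadj _ (hS' a) _).2 (hT' b)
      · simp at h
    · rintro (a | a) (b | b) h
      · have := h.ne
        simpa [join] using this
      · simp [join]
      · simp [join]
      · have h' : G.Adj (eS a) (eS b) := by simpa using h
        exact absurd (hS' b) ((hadj _ (hS' a) _).1 h')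

end HamSpec

theorem theorem1p6 {V : Type*} [Fintype V] [DecidableEq V] (n k : ℕ)
    (hn : Fintype.card V = n) :
    -- (1) traceability
    (2 * k + 2 ≤ n →
      (∀ G : SimpleGraph V, k ≤ HamSpec.minDeg G →
        HamSpec.spectralRadius Gᶜ ≤ HamSpec.spectralRadius (HamSpec.Lbar n k)ᶜ →
        (HamSpec.IsTraceable G ↔
          ¬ (Nonempty (G ≃g HamSpec.Lbar n k) ∨ (n = 2 * k + 2 ∧ HamSpec.InH G)))) ∧
      IsLeast {r : ℝ | ∃ G : SimpleGraph V, k ≤ HamSpec.minDeg G ∧ ¬ HamSpec.IsTraceable G ∧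
          HamSpec.spectralRadius Gᶜ = r}
        (HamSpec.spectralRadius (HamSpec.Lbar n k)ᶜ)) ∧
    -- (2) Hamiltonicity
    (1 ≤ k → 2 * k + 1 ≤ n →
      (∀ G : SimpleGraph V, k ≤ HamSpec.minDeg G →
        HamSpec.spectralRadius Gᶜ ≤ HamSpec.spectralRadius (HamSpec.L n k)ᶜ →
        (G.IsHamiltonian ↔
          ¬ (Nonempty (G ≃g HamSpec.L n k) ∨ (n = 2 * k + 1 ∧ HamSpec.InH G)))) ∧
      IsLeast {r : ℝ | ∃ G : SimpleGraph V, k ≤ HamSpec.minDeg G ∧ ¬ G.IsHamiltonian ∧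
          HamSpec.spectralRadius Gᶜ = r}
        (HamSpec.spectralRadius (HamSpec.L n k)ᶜ)) := by
  open HamSpec in
  constructor
  · intro hkn
    have : Nonempty V := Fintype.card_pos_iff.1 (by omega)
    have hcard : Fintype.card (Fin (k + 1) ⊕ Fin (n - k - 1)) = n := by
      simp only [Fintype.card_sum, Fintype.card_fin]
      omega
    have hshape : HasLbarShape (Lbar n k) k :=
      (nonempty_iso_Lbar_iff hcard (by omega)).1 ⟨SimpleGraph.Iso.refl⟩
    have hρ : spectralRadius (Lbar n k)ᶜ = √((k + 1 : ℕ) * (n - k - 1 : ℕ)) :=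
      le_antisymm (hshape.spectralRadius_compl_le hcard)
        (sqrt_le_spectralRadius_compl_of_not_isTraceable hcard hkn
          (hshape.not_isTraceable (by omega) hcard) (hshape.le_deg hkn hcard)).1
    rw [hρ]
    refine ⟨fun G hd hle => ?_, ?_, ?_⟩
    · rw [nonempty_iso_Lbar_iff hn (by omega), inH_iff (by omega)]
      constructor
      · rintro ht (h | ⟨h1, h2⟩)
        · exact h.not_isTraceable (by omega) hn ht
        · exact h2.not_isTraceable (hn.trans h1) ht
      · intro h
        by_contra ht
        exact h ((sqrt_le_spectralRadius_compl_of_not_isTraceable hn hkn ht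
          (le_minDeg_iff.1 hd)).2 hle)
    · let e : V ≃ Fin (k + 1) ⊕ Fin (n - k - 1) := Fintype.equivOfCardEq (hn.trans hcard.symm)
      have hs : HasLbarShape ((Lbar n k).comap e) k :=
        (nonempty_iso_Lbar_iff hn (by omega)).1 ⟨SimpleGraph.Iso.comap e _⟩
      have hnt := hs.not_isTraceable (by omega) hn
      have hd := hs.le_deg hkn hn
      exact ⟨_, le_minDeg_iff.2 hd, hnt, le_antisymm (hs.spectralRadius_compl_le hn)
        (sqrt_le_spectralRadius_compl_of_not_isTraceable hn hkn hnt hd).1⟩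
    · rintro _ ⟨G, hd, ht, rfl⟩
      exact (sqrt_le_spectralRadius_compl_of_not_isTraceable hn hkn ht (le_minDeg_iff.1 hd)).1
  · intro hk hkn
    have : Nonempty V := Fintype.card_pos_iff.1 (by omega)
    have hcard : Fintype.card (Fin 1 ⊕ (Fin k ⊕ Fin (n - k - 1))) = n := by
      simp only [Fintype.card_sum, Fintype.card_fin]
      omega
    have hshape : HasLShape (L n k) k :=
      (nonempty_iso_L_iff hcard (by omega)).1 ⟨SimpleGraph.Iso.refl⟩
    have hρ : spectralRadius (L n k)ᶜ = √(k * (n - k - 1 : ℕ)) :=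
      le_antisymm (hshape.spectralRadius_compl_le hcard)
        (sqrt_le_spectralRadius_compl hcard hk hkn
          (hshape.not_isHamiltonian hk (by omega) hcard) (hshape.le_deg hkn hcard)).1
    rw [hρ]
    refine ⟨fun G hd hle => ?_, ?_, ?_⟩
    · rw [nonempty_iso_L_iff hn (by omega), inH_iff (by omega)]
      constructor
      · rintro ht (h | ⟨-, h⟩)
        · exact h.not_isHamiltonian hk (by omega) hn ht
        · exact h.not_isHamiltonian (by omega) hn ht
      · intro h
        by_contra ht
        exact h ((sqrt_le_spectralRadius_compl hn hk hkn ht (le_minDeg_iff.1 hd)).2 hle)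
    · let e : V ≃ Fin 1 ⊕ (Fin k ⊕ Fin (n - k - 1)) :=
        Fintype.equivOfCardEq (hn.trans hcard.symm)
      have hs : HasLShape ((L n k).comap e) k :=
        (nonempty_iso_L_iff hn (by omega)).1 ⟨SimpleGraph.Iso.comap e _⟩
      have hnt := hs.not_isHamiltonian hk (by omega) hn
      have hd := hs.le_deg hkn hn
      exact ⟨_, le_minDeg_iff.2 hd, hnt, le_antisymm (hs.spectralRadius_compl_le hn)
        (sqrt_le_spectralRadius_compl hn hk hkn hnt hd).1⟩
    · rintro _ ⟨G, hd, ht, rfl⟩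
      exact (sqrt_le_spectralRadius_compl hn hk hkn ht (le_minDeg_iff.1 hd)).1
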